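/- Let $N$ be a finite-dimensional smooth ($C^\infty$, Hausdorff) manifold without boundary, and let $F:TN\to[0,\infty)$ be a smooth Finsler metric: $F(rv)=rF(v)$ for $r\ge 0$, $F$ is $C^\infty$ on $TN\setminus 0$, and for every $x\in N$ and $w\in T_xN\setminus\{0\}$ the bilinear form $$g_w(u,v)=\tfrac12\,\frac{\partial^2}{\partial s\,\partial t}\Big|_{s=t=0}F^2(w+su+tv)\qquad(u,v\in T_xN)$$ is positive definite. ($F$ need not be reversible.) For $p\in N$ let $\exp_p(v)=\gamma_v(1)$, where $\gamma_v$ is the geodesic of $F$ with $\dot\gamma_v(0)=v\in T_pN$, whenever $\gamma_v$ is defined on an open interval containing $[0,1]$; geodesics are the constant curves and the curves with nowhere vanishing velocity that satisfy the Euler-Lagrange equations of $\tfrac12F^2$ in local coordinates. Then for every point $p\in N$ the differential $D\exp_p$ is Lipschitz continuous near $0\in T_pN$, i.e. $\exp_p$ is of class $C^{1,1}$ near the origin. Precisely: fix a norm on $T_pN$ and let $\varphi$ be any chart of the smooth structure of $N$ around $p$, with values in a normed space. Then there are $\varepsilon>0$ and $C\ge 0$ such that $\exp_p$ is defined on the ball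 $B_\varepsilon(0)\subset T_pN$ and maps it into the domain of $\varphi$, the map $\varphi\circ\exp_p$ is $C^1$ on $B_\varepsilon(0)$, and $$\|D(\varphi\circ\exp_p)(v)-D(\varphi\circ\exp_p)(w)\|\le C\,\|v-w\|\qquad\text{for all } v,w\in B_\varepsilon(0).$$ -/

import Mathlib

open Set Filter Topology Metric
open scoped Manifold ContDiff NNReal

noncomputable section

/-- The velocity `γ'(t)` of a curve in a manifold, as a point of the tangent bundle over `γ t`. -/
def curveVelocity {E : Type*} [NormedAddCommGroup E] [NormedSpace ℝ E]
    {N : Type*} [TopologicalSpace N] [ChartedSpace E N]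
    (γ : ℝ → N) (t : ℝ) : TangentBundle 𝓘(ℝ, E) N :=
  ⟨γ t, mfderiv 𝓘(ℝ, ℝ) 𝓘(ℝ, E) γ t (1 : ℝ)⟩

/-- The bilinear form `g_w(u, v) = ½ ∂²/∂s∂t F²(w + s u + t v)` at `s = t = 0`, for `w, u, v` in the
tangent space at `x`. -/
def finslerFundamentalTensor {E : Type*} [NormedAddCommGroup E] [NormedSpace ℝ E]
    {N : Type*} [TopologicalSpace N] [ChartedSpace E N]
    (F : TangentBundle 𝓘(ℝ, E) N → ℝ) (x : N) (w u v : TangentSpace 𝓘(ℝ, E) x) : ℝ :=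
  deriv (fun s : ℝ => deriv (fun t : ℝ => F ⟨x, w + s • u + t • v⟩ ^ 2) 0) 0 / 2

/-- A smooth Finsler metric on a smooth manifold without boundary modelled on `E`: a nonnegative,
positively homogeneous function on the tangent bundle, smooth off the zero section, whose
fundamental tensor is positive definite at every nonzero vector. Reversibility is not required. -/
structure FinslerMetric (E : Type*) [NormedAddCommGroup E] [NormedSpace ℝ E]
    (N : Type*) [TopologicalSpace N] [ChartedSpace E N] [IsManifold 𝓘(ℝ, E) ∞ N] where
  toFun : TangentBundle 𝓘(ℝ, E) N → ℝ
  nonneg : ∀ w, 0 ≤ toFun w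
  homogeneous : ∀ (x : N) (v : TangentSpace 𝓘(ℝ, E) x) (r : ℝ), 0 ≤ r →
    toFun ⟨x, r • v⟩ = r * toFun ⟨x, v⟩
  smooth : ContMDiffOn 𝓘(ℝ, E).tangent 𝓘(ℝ, ℝ) ∞ toFun {w | w.2 ≠ 0}
  posDef : ∀ (x : N) (w u : TangentSpace 𝓘(ℝ, E) x), w ≠ 0 → u ≠ 0 →
    0 < finslerFundamentalTensor toFun x w u u

namespace FinslerMetric

variable {E : Type*} [NormedAddCommGroup E] [NormedSpace ℝ E]
  {N : Type*} [TopologicalSpace N] [ChartedSpace E N] [IsManifold 𝓘(ℝ, E) ∞ N]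

/-- The energy Lagrangian `L = ½ F²` in the coordinates of the chart `e`: the position `x` ranges
over `e.target`, and the coordinate vector `v` stands for the tangent vector `D(e⁻¹)(x) v`. -/
def chartLagrangian (F : FinslerMetric E N) (e : OpenPartialHomeomorph N E) (x v : E) : ℝ :=
  F.toFun ⟨e.symm x, mfderiv 𝓘(ℝ, E) 𝓘(ℝ, E) e.symm x v⟩ ^ 2 / 2

/-- The Euler-Lagrange equation `d/dt (∂L/∂v (c, c')) = ∂L/∂x (c, c')` of `L = ½ F²` at time `t`,
for the coordinate expression `c = e ∘ γ` of the curve `γ` in the chart `e`. -/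
def EulerLagrangeAt (F : FinslerMetric E N) (e : OpenPartialHomeomorph N E)
    (γ : ℝ → N) (t : ℝ) : Prop :=
  HasDerivAt
    (fun s => fderiv ℝ (fun v => F.chartLagrangian e (e (γ s)) v) (deriv (e ∘ γ) s))
    (fderiv ℝ (fun x => F.chartLagrangian e x (deriv (e ∘ γ) t)) (e (γ t))) t

/-- `γ` is a (constant speed) geodesic on the open interval `J`: it is either constant, or a curve
with nowhere vanishing velocity that solves the Euler-Lagrange equation of `½ F²` in all charts of
the smooth structure. (Curves of class `C²` with this property are automatically smooth.) -/
def IsGeodesicOn (F : FinslerMetric E N) (γ : ℝ → N) (J : Set ℝ) : Prop :=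
  ContMDiffOn 𝓘(ℝ, ℝ) 𝓘(ℝ, E) 2 γ J ∧
    ((∃ q : N, ∀ t ∈ J, γ t = q) ∨
      ∀ t ∈ J, (curveVelocity (E := E) γ t).2 ≠ 0 ∧
        ∀ e ∈ IsManifold.maximalAtlas 𝓘(ℝ, E) ∞ N, γ t ∈ e.source → F.EulerLagrangeAt e γ t)

/-- The domain of `exp_p`: those `v ∈ T_pN` for which a geodesic with initial velocity `v` exists
on an open interval containing `[0, 1]`. -/
def expDomain (F : FinslerMetric E N) (p : N) : Set (TangentSpace 𝓘(ℝ, E) p) :=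
  {v | ∃ γ : ℝ → N, curveVelocity (E := E) γ 0 = ⟨p, v⟩ ∧
    ∃ ε : ℝ, 0 < ε ∧ F.IsGeodesicOn γ (Ioo (-ε) (1 + ε))}

open Classical in
/-- The exponential map `exp_p(v) = γ_v(1)`, where `γ_v` is the geodesic with initial velocity
`v ∈ T_pN` (with the dummy value `p` outside its domain). -/
def exp (F : FinslerMetric E N) (p : N) (v : TangentSpace 𝓘(ℝ, E) p) : N :=
  if h : v ∈ F.expDomain p then h.choose 1 else p

end FinslerMetric

end

/-! In a chart the geodesics solve `y'' = Q(y, y')`, where the spray `Q` comes from the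
Euler-Lagrange equation of `½F²` by inverting the fibre Hessian. Off the zero section `Q` is smooth,
and it is positively 2-homogeneous in the fibre. Hence its second derivative, controlled by
compactness on unit vectors over a small ball, stays bounded as the vector shrinks to zero, while
its first derivative is `O(‖v‖)`. So `DQ` is Lipschitz across the zero section
(`exists_lipschitzOnWith_fderiv_of_homogeneous`).

The geodesic field is therefore `C^{1,1}` near `(p, 0)`, and so is its local flow in the initial
point: Lipschitz dependence is applied to the flow coupled with its variational equation
(`exists_flow_of_lipschitzOnWith_fderiv`). By homogeneity, flowing for a short time `δ` with initial
velocity `δ⁻¹v` ends where the geodesic of `v` ends at time 1. Thus `exp_p` in the chart is a linear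
map into phase space, the time-`δ` flow, and a projection (`exists_exp_eq_chart_symm`).

The definition of `exp` also requires that spray solutions satisfy the Euler-Lagrange equation in
every chart (`eulerLagrange_comp`) and that geodesics are unique (`IsRegularGeodesicOn.eqOn`). -/

/-! ### Flows of vector fields with Lipschitz derivative -/

/-- Picard–Lindelöf for an autonomous Lipschitz vector field on a closed ball: a local flow that
stays in the ball and is Lipschitz in the initial point. -/
theorem exists_flow_of_lipschitzOnWith {G : Type*} [NormedAddCommGroup G] [NormedSpace ℝ G]
    [CompleteSpace G] {V : G → G} {c : G} {a : ℝ} (ha : 0 < a) {K : ℝ≥0}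
    (hV : LipschitzOnWith K V (closedBall c a)) :
    ∃ T : ℝ, 0 < T ∧ ∃ (α : G → ℝ → G) (C : ℝ≥0),
      (∀ z ∈ closedBall c (a / 2), α z 0 = z ∧ (∀ t, α z t ∈ closedBall c a) ∧
        ∀ t ∈ Ioo (-T) T, HasDerivAt (α z) (V (α z t)) t) ∧
      ∀ t ∈ Ioo (-T) T, LipschitzOnWith C (α · t) (closedBall c (a / 2)) := by
  classical
  lift a to ℝ≥0 using ha.le
  obtain ⟨r, hr⟩ : ∃ r : ℝ≥0, (r : ℝ) = a / 2 := ⟨a / 2, by simp⟩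
  rw [← hr]
  set L : ℝ≥0 := .mk (K * a + ‖V c‖ + 1) (by positivity) with hL
  have hL0 : (0 : ℝ) < L := by rw [hL, NNReal.coe_mk]; positivity
  have hb : ∀ x ∈ closedBall c a, ‖V x‖ ≤ L := by
    intro x hx
    have h1 := hV.norm_sub_le hx (mem_closedBall_self ha.le)
    have h2 : ‖x - c‖ ≤ a := mem_closedBall_iff_norm.mp hx
    have h3 : ‖V x‖ ≤ ‖V x - V c‖ + ‖V c‖ := norm_le_norm_sub_add _ _
    have h4 : (K : ℝ) * ‖x - c‖ ≤ K * a := by gcongr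
    rw [hL, NNReal.coe_mk]
    linarith
  -- At speed at most `L`, a curve starting within `a / 2` of `c` stays within `a` up to time `T`.
  set T : ℝ := a / 2 / L with hT
  have hT0 : 0 < T := by positivity
  have h0 : (0 : ℝ) ∈ Icc (-T) T := ⟨by linarith, hT0.le⟩
  have hf : IsPicardLindelof (fun _ ↦ V) (tmin := -T) (tmax := T) ⟨0, h0⟩ c a r L K := by
    refine IsPicardLindelof.of_time_independent hb hV ?_
    simp only [sub_zero, zero_sub, neg_neg, max_self, hT]
    rw [mul_div_cancel₀ _ hL0.ne']
    linarith
  have key (x) (hx : x ∈ closedBall c r) := ODE.FunSpace.exists_isFixedPt_next hf hx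
  choose α hα using key
  -- `compProj` clamps time to `[-T, T]`, so the curve stays in the ball for every real time.
  refine ⟨T, hT0, fun x ↦ if hx : x ∈ closedBall c r then (α x hx).compProj else 0, ?_⟩
  obtain ⟨L', h⟩ := ODE.FunSpace.exists_forall_closedBall_funSpace_dist_le_mul hf
  refine ⟨L', fun x hx ↦ ⟨?_, ?_, fun t ht ↦ ?_⟩, fun t ht ↦ ?_⟩
  · simp only [dif_pos hx]
    rw [ODE.FunSpace.compProj_of_mem h0, ← hα, ODE.FunSpace.next_apply₀]
  · intro t
    simp only [dif_pos hx]
    exact (α x hx).compProj_mem_closedBall hf.mul_max_le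
  · simp only [dif_pos hx]
    refine HasDerivWithinAt.hasDerivAt ?_ (Icc_mem_nhds ht.1 ht.2)
    apply ODE.hasDerivWithinAt_picard_Icc h0 hf.continuousOn_uncurry
      (α x hx |>.continuous_compProj.continuousOn)
      (fun _ ht' ↦ α x hx |>.compProj_mem_closedBall hf.mul_max_le)
      x (Ioo_subset_Icc_self ht) |>.congr_of_mem _ (Ioo_subset_Icc_self ht)
    intro t' ht'
    nth_rw 1 [← hα]
    rw [ODE.FunSpace.compProj_of_mem ht', ODE.FunSpace.next_apply]
  · refine LipschitzOnWith.of_dist_le_mul fun x hx y hy ↦ ?_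
    simp only [dif_pos hx, dif_pos hy]
    rw [ODE.FunSpace.compProj_apply, ODE.FunSpace.compProj_apply,
      ← ODE.FunSpace.toContinuousMap_apply_eq_apply, ← ODE.FunSpace.toContinuousMap_apply_eq_apply]
    have : Nonempty (Icc (-T) T) := ⟨⟨0, h0⟩⟩
    apply ContinuousMap.dist_le_iff_of_nonempty.mp
    exact h x y hx hy (α x hx) (α y hy) (hα x hx) (hα y hy)

/-- Linearity in the defect: a defect quadratic in the displacement gives a quadratic error. -/
theorem gronwallBound_zero_mul (K ε x : ℝ) :
    gronwallBound 0 K ε x = ε * gronwallBound 0 K 1 x := by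
  unfold gronwallBound
  split_ifs <;> ring

/-- A quadratic Taylor estimate for maps with Lipschitz derivative. -/
theorem norm_sub_sub_le_of_lipschitzOnWith_fderiv {G H : Type*} [NormedAddCommGroup G]
    [NormedSpace ℝ G] [NormedAddCommGroup H] [NormedSpace ℝ H] {X : G → H} {DX : G → G →L[ℝ] H}
    {s : Set G} (hs : Convex ℝ s) {K : ℝ≥0} (hX : ∀ z ∈ s, HasFDerivAt X (DX z) z)
    (hDX : LipschitzOnWith K DX s) {x y : G} (hx : x ∈ s) (hy : y ∈ s) :
    ‖X y - X x - DX x (y - x)‖ ≤ K * ‖y - x‖ ^ 2 := by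
  have hseg : segment ℝ x y ⊆ s := hs.segment_subset hx hy
  have := (convex_segment x y).norm_image_sub_le_of_norm_hasFDerivWithin_le'
    (f := X) (f' := DX) (φ := DX x) (C := K * ‖y - x‖)
    (fun z hz ↦ (hX z (hseg hz)).hasFDerivWithinAt)
    (fun z hz ↦ (hDX.norm_sub_le (hseg hz) hx).trans
      (by gcongr; exact norm_sub_le_of_mem_segment hz))
    (left_mem_segment ℝ x y) (right_mem_segment ℝ x y)
  linarith

/-- A map with Lipschitz derivative on a closed ball has bounded derivative there, and is hence
Lipschitz. -/
theorem exists_lipschitzOnWith_of_lipschitzOnWith_fderiv {G H : Type*} [NormedAddCommGroup G]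
    [NormedSpace ℝ G] [NormedAddCommGroup H] [NormedSpace ℝ H] {X : G → H} {DX : G → G →L[ℝ] H}
    {c : G} {a : ℝ} (ha : 0 < a) {K : ℝ≥0} (hX : ∀ z ∈ closedBall c a, HasFDerivAt X (DX z) z)
    (hDX : LipschitzOnWith K DX (closedBall c a)) :
    ∃ B : ℝ≥0, (∀ z ∈ closedBall c a, ‖DX z‖ ≤ B) ∧ LipschitzOnWith B X (closedBall c a) := by
  have hcc : c ∈ closedBall c a := mem_closedBall_self ha.le
  obtain ⟨B, hB⟩ : ∃ B : ℝ≥0, ∀ z ∈ closedBall c a, ‖DX z‖ ≤ B := by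
    refine ⟨.mk (K * a + ‖DX c‖) (by positivity), fun z hz ↦ ?_⟩
    have h1 := hDX.norm_sub_le hz hcc
    have h2 : ‖z - c‖ ≤ a := mem_closedBall_iff_norm.mp hz
    have h3 : ‖DX z‖ ≤ ‖DX z - DX c‖ + ‖DX c‖ := norm_le_norm_sub_add _ _
    have h4 : (K : ℝ) * ‖z - c‖ ≤ K * a := by gcongr
    rw [NNReal.coe_mk]
    linarith
  have hXlip : LipschitzOnWith B X (closedBall c a) :=
    (convex_closedBall c a).lipschitzOnWith_of_nnnorm_hasFDerivWithin_le
      (fun z hz ↦ (hX z hz).hasFDerivWithinAt) hB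
  exact ⟨B, hB, hXlip⟩

/-- The local flow of a vector field of class `C^{1,1}` is of class `C^{1,1}` in the initial
point. -/
theorem exists_flow_of_lipschitzOnWith_fderiv {G : Type*} [NormedAddCommGroup G] [NormedSpace ℝ G]
    [CompleteSpace G] {X : G → G} {DX : G → G →L[ℝ] G} {c : G} {a : ℝ} (ha : 0 < a) {K : ℝ≥0}
    (hX : ∀ z ∈ closedBall c a, HasFDerivAt X (DX z) z)
    (hDX : LipschitzOnWith K DX (closedBall c a)) :
    ∃ T : ℝ, 0 < T ∧ ∃ r : ℝ, 0 < r ∧ ∃ (α : G → ℝ → G) (A : G → ℝ → G →L[ℝ] G) (C : ℝ≥0),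
      (∀ z ∈ ball c r, α z 0 = z ∧ (∀ t, α z t ∈ closedBall c a) ∧
        ∀ t ∈ Ioo (-T) T, HasDerivAt (α z) (X (α z t)) t) ∧
      ∀ t ∈ Ico 0 T, (∀ z ∈ ball c r, HasFDerivAt (α · t) (A z t) z) ∧
        LipschitzOnWith C (A · t) (ball c r) := by
  obtain ⟨B, hB, hXlip⟩ := exists_lipschitzOnWith_of_lipschitzOnWith_fderiv ha hX hDX
  set c' : G × (G →L[ℝ] G) := (c, ContinuousLinearMap.id ℝ G) with hc'
  -- The second component obeys the variational equation, so it is the candidate derivative of the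
  -- flow. Lipschitz dependence of the coupled flow then bounds that derivative's variation.
  set V : G × (G →L[ℝ] G) → G × (G →L[ℝ] G) := fun p ↦ (X p.1, (DX p.1).comp p.2) with hV
  -- Half the radius leaves room for the linear approximation `y + Y h` inside the ball of radius
  -- `a`.
  set b : ℝ := a / 2 with hb
  have hb0 : 0 < b := by positivity
  have hmem : ∀ p ∈ closedBall c' b, p.1 ∈ closedBall c b ∧ ‖p.2‖ ≤ 1 + b := by
    rintro ⟨p, P⟩ hp
    rw [hc', ← closedBall_prod_same] at hp
    refine ⟨hp.1, ?_⟩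
    have h1 : ‖P - ContinuousLinearMap.id ℝ G‖ ≤ b := mem_closedBall_iff_norm.mp hp.2
    have h2 : ‖P‖ ≤ ‖P - ContinuousLinearMap.id ℝ G‖ + ‖ContinuousLinearMap.id ℝ G‖ :=
      norm_le_norm_sub_add _ _
    have h3 := ContinuousLinearMap.norm_id_le (𝕜 := ℝ) (E := G)
    simp only
    linarith
  have hba : closedBall c b ⊆ closedBall c a := closedBall_subset_closedBall (by linarith)
  have hVlip : LipschitzOnWith (B + K * .mk (1 + b) (by positivity)) V (closedBall c' b) := by
    refine LipschitzOnWith.of_dist_le_mul fun p hp q hq ↦ ?_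
    obtain ⟨hp1, hp2⟩ := hmem p hp
    obtain ⟨hq1, hq2⟩ := hmem q hq
    have d1 : ‖p.1 - q.1‖ ≤ ‖p - q‖ := norm_fst_le (p - q)
    have d2 : ‖p.2 - q.2‖ ≤ ‖p - q‖ := norm_snd_le (p - q)
    rw [dist_eq_norm, dist_eq_norm]
    simp only [NNReal.coe_add, NNReal.coe_mul, NNReal.coe_mk]
    refine max_le ?_ ?_
    · have h1 : ‖X p.1 - X q.1‖ ≤ B * ‖p.1 - q.1‖ := hXlip.norm_sub_le (hba hp1) (hba hq1)
      have h2 : (B : ℝ) * ‖p.1 - q.1‖ ≤ B * ‖p - q‖ := by gcongr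
      have h3 : 0 ≤ (K : ℝ) * (1 + b) * ‖p - q‖ := by positivity
      change ‖X p.1 - X q.1‖ ≤ _
      linarith
    · have e : (V p - V q).2 = (DX p.1).comp (p.2 - q.2) + (DX p.1 - DX q.1).comp q.2 := by
        ext v; simp [hV]
      have h1 : ‖(DX p.1).comp (p.2 - q.2)‖ ≤ B * ‖p - q‖ :=
        (ContinuousLinearMap.opNorm_comp_le _ _).trans
          (mul_le_mul (hB _ (hba hp1)) d2 (norm_nonneg _) B.2)
      have h2 : ‖(DX p.1 - DX q.1).comp q.2‖ ≤ (K * ‖p - q‖) * (1 + b) :=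
        (ContinuousLinearMap.opNorm_comp_le _ _).trans
          (mul_le_mul ((hDX.norm_sub_le (hba hp1) (hba hq1)).trans (by gcongr)) hq2
            (norm_nonneg _) (by positivity))
      rw [e]
      refine (norm_add_le _ _).trans ?_
      linarith
  obtain ⟨T, hT0, β, C, hβ, hβlip⟩ := exists_flow_of_lipschitzOnWith hb0 hVlip
  have hin : ∀ z ∈ ball c (b / 2), ((z, ContinuousLinearMap.id ℝ G) : G × (G →L[ℝ] G)) ∈
      closedBall c' (b / 2) := by
    intro z hz
    rw [hc', ← closedBall_prod_same]
    exact ⟨ball_subset_closedBall hz, mem_closedBall_self (by positivity)⟩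
  refine ⟨T, hT0, b / 2, by positivity, fun z t ↦ (β (z, ContinuousLinearMap.id ℝ G) t).1,
    fun z t ↦ (β (z, ContinuousLinearMap.id ℝ G) t).2, C, ?_, ?_⟩
  · intro z hz
    obtain ⟨h1, h2, h3⟩ := hβ _ (hin z hz)
    exact ⟨by simp only [h1], fun t ↦ hba (hmem _ (h2 t)).1, fun t ht ↦ (h3 t ht).fst⟩
  · intro t ht
    have htI : t ∈ Ioo (-T) T := ⟨by linarith [ht.1], ht.2⟩
    refine ⟨fun z hz ↦ ?_, ?_⟩
    · obtain ⟨h1, h2, h3⟩ := hβ _ (hin z hz)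
      set y : ℝ → G := fun s ↦ (β (z, ContinuousLinearMap.id ℝ G) s).1 with hy
      set Y : ℝ → G →L[ℝ] G := fun s ↦ (β (z, ContinuousLinearMap.id ℝ G) s).2 with hY
      have hy' : ∀ s ∈ Ioo (-T) T, HasDerivAt y (X (y s)) s := fun s hs ↦ (h3 s hs).fst
      have hY' : ∀ s ∈ Ioo (-T) T, HasDerivAt Y ((DX (y s)).comp (Y s)) s :=
        fun s hs ↦ (h3 s hs).snd
      have hsub : Icc 0 t ⊆ Ioo (-T) T := fun s hs ↦ ⟨by linarith [hs.1], by linarith [hs.2, ht.2]⟩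
      have hsub' : Ico 0 t ⊆ Ioo (-T) T := Ico_subset_Icc_self.trans hsub
      set M : ℝ := K * (1 + b) ^ 2 * gronwallBound 0 B 1 (t - 0)
      have key : ∀ᶠ z' in 𝓝 z, ‖(β (z', ContinuousLinearMap.id ℝ G) t).1 - y t - Y t (z' - z)‖ ≤
          M * ‖z' - z‖ ^ 2 := by
        have e1 : ∀ᶠ z' in 𝓝 z, z' ∈ ball c (b / 2) := isOpen_ball.mem_nhds hz
        have e2 : ∀ᶠ z' in 𝓝 z, (1 + b) * ‖z' - z‖ < b := by
          have : Tendsto (fun z' ↦ (1 + b) * ‖z' - z‖) (𝓝 z) (𝓝 ((1 + b) * ‖z - z‖)) :=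
            Continuous.tendsto (by fun_prop) z
          refine this.eventually_lt_const ?_
          simpa using hb0
        filter_upwards [e1, e2] with z' hz' hzz
        obtain ⟨k1, k2, k3⟩ := hβ _ (hin z' hz')
        set h := z' - z with hh
        have hYh : ∀ s, ‖Y s h‖ ≤ (1 + b) * ‖h‖ := fun s ↦
          ((Y s).le_opNorm h).trans (by gcongr; exact (hmem _ (h2 s)).2)
        have hw : ∀ s, y s + Y s h ∈ closedBall c a := by
          intro s
          rw [mem_closedBall_iff_norm, add_sub_right_comm]
          refine (norm_add_le _ _).trans ?_
          have := mem_closedBall_iff_norm.mp (hmem _ (h2 s)).1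
          linarith [hYh s]
        have hder : ∀ s ∈ Ioo (-T) T, HasDerivAt (fun s ↦ y s + Y s h)
            (X (y s) + DX (y s) (Y s h)) s := fun s hs ↦
          (hy' s hs).add ((hY' s hs).clm_apply (hasDerivAt_const s h) |>.congr_deriv (by simp))
        have hder' : ∀ s ∈ Ioo (-T) T, HasDerivAt
            (fun s ↦ (β (z', ContinuousLinearMap.id ℝ G) s).1)
            (X (β (z', ContinuousLinearMap.id ℝ G) s).1) s := fun s hs ↦ (k3 s hs).fst
        -- Grönwall: `y + Y h` starts at `z'` and solves the equation up to the Taylor remainder `K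
        -- ‖Y h‖²`, so it is quadratically close to the true solution.
        have := dist_le_of_approx_trajectories_ODE_of_mem (v := fun _ ↦ X) (K := B)
          (s := fun _ ↦ closedBall c a) (a := 0) (b := t) (δ := 0) (εf := 0)
          (εg := K * ((1 + b) * ‖h‖) ^ 2)
          (fun _ _ ↦ hXlip)
          (HasDerivAt.continuousOn fun s hs ↦ hder' s (hsub hs))
          (fun s hs ↦ (hder' s (hsub' hs)).hasDerivWithinAt)
          (fun s hs ↦ by simp)
          (fun s hs ↦ hba (hmem _ (k2 s)).1)
          (HasDerivAt.continuousOn fun s hs ↦ hder s (hsub hs))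
          (fun s hs ↦ (hder s (hsub' hs)).hasDerivWithinAt)
          (fun s hs ↦ by
            have q := norm_sub_sub_le_of_lipschitzOnWith_fderiv (convex_closedBall c a) hX hDX
              (hba (hmem _ (h2 s)).1) (hw s)
            rw [add_sub_cancel_left] at q
            rw [dist_comm, dist_eq_norm, ← sub_sub]
            refine q.trans ?_
            gcongr
            exact hYh s)
          (fun s hs ↦ hw s)
          (by simp only [hy, hY, h1, k1, hh]; simp) t ⟨ht.1, le_rfl⟩
        rw [dist_eq_norm, ← sub_sub, gronwallBound_zero_mul] at this
        refine this.trans (le_of_eq ?_)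
        ring
      rw [hasFDerivAt_iff_isLittleO]
      refine Asymptotics.IsBigO.trans_isLittleO (g := fun z' ↦ ‖z' - z‖ ^ 2) ?_ ?_
      · refine Asymptotics.IsBigO.of_bound M ?_
        filter_upwards [key] with z' hz'
        simpa using hz'
      · have := (Asymptotics.isLittleO_norm_pow_id (E' := G) one_lt_two).comp_tendsto
          (tendsto_sub_nhds_zero_iff.mpr (tendsto_id (α := G) (x := 𝓝 z)))
        exact this
    · refine LipschitzOnWith.of_dist_le_mul fun z hz z' hz' ↦ ?_
      have h := (hβlip t htI).dist_le_mul _ (hin z hz) _ (hin z' hz')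
      refine ((le_max_right _ _).trans h).trans (le_of_eq ?_)
      simp [Prod.dist_eq]

/-! ### Homogeneous maps and regularity across the zero section -/

/-- The fibre scaling `(x, v) ↦ (x, r v)`. -/
def fiberScale (E : Type*) [NormedAddCommGroup E] [NormedSpace ℝ E] (r : ℝ) : E × E →L[ℝ] E × E :=
  (ContinuousLinearMap.id ℝ E).prodMap (r • ContinuousLinearMap.id ℝ E)

section Homogeneous

variable {E : Type*} [NormedAddCommGroup E] [NormedSpace ℝ E]
  {H : Type*} [NormedAddCommGroup H] [NormedSpace ℝ H]

@[simp] theorem fiberScale_apply (r : ℝ) (z : E × E) : fiberScale E r z = (z.1, r • z.2) := rfl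

theorem norm_fiberScale_le {r : ℝ} (hr : 1 ≤ r) : ‖fiberScale E r‖ ≤ r := by
  refine ContinuousLinearMap.opNorm_le_bound _ (by linarith) fun z ↦ ?_
  refine max_le ?_ ?_
  · have := norm_fst_le z
    have h0 := norm_nonneg z
    simp only [fiberScale_apply]
    nlinarith
  · simp only [fiberScale_apply, norm_smul, Real.norm_eq_abs, abs_of_nonneg (zero_le_one.trans hr)]
    gcongr
    exact norm_snd_le z

/-- Chain rule on both sides. An operator weight `Λ` lets the lemma apply to `Q` and again to
`fderiv ℝ Q`, whose values are themselves transformed by precomposition. -/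
theorem fderiv_fiberScale {f : E × E → H}
    {z : E × E} {r : ℝ} (hr : r ≠ 0) {Λ : H →L[ℝ] H} (hz : DifferentiableAt ℝ f z)
    (hrz : DifferentiableAt ℝ f (fiberScale E r z))
    (h : ∀ᶠ y in 𝓝 z, f (fiberScale E r y) = Λ (f y)) :
    fderiv ℝ f (fiberScale E r z) = Λ ∘L fderiv ℝ f z ∘L fiberScale E r⁻¹ := by
  have h1 : HasFDerivAt (fun y ↦ f (fiberScale E r y))
      (fderiv ℝ f (fiberScale E r z) ∘L fiberScale E r) z :=
    hrz.hasFDerivAt.comp z (fiberScale E r).hasFDerivAt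
  have h2 : HasFDerivAt (fun y ↦ Λ (f y)) (Λ ∘L fderiv ℝ f z) z :=
    Λ.hasFDerivAt.comp z hz.hasFDerivAt
  have h3 := h1.unique (h2.congr_of_eventuallyEq h)
  refine ContinuousLinearMap.ext fun y ↦ ?_
  have := congrArg (fun A : E × E →L[ℝ] H ↦ A (fiberScale E r⁻¹ y)) h3
  simpa [smul_smul, hr] using this

/-- The derivative of a positively `2`-homogeneous map at a scaled vector. -/
theorem fderiv_homogeneous {Q : E × E → H} {U : Set E} (hU : IsOpen U)
    (hQ : ContDiffOn ℝ 2 Q (U ×ˢ {0}ᶜ))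
    (hom : ∀ x ∈ U, ∀ (v : E) (r : ℝ), 0 ≤ r → Q (x, r • v) = r ^ 2 • Q (x, v)) {r : ℝ}
    (hr : 0 < r) {z : E × E} (hz : z ∈ U ×ˢ ({0}ᶜ : Set E)) :
    fderiv ℝ Q (fiberScale E r z) = r ^ 2 • (fderiv ℝ Q z ∘L fiberScale E r⁻¹) := by
  have hOo : IsOpen (U ×ˢ ({0}ᶜ : Set E)) := hU.prod isOpen_compl_singleton
  have hdQ : ∀ z ∈ U ×ˢ ({0}ᶜ : Set E), DifferentiableAt ℝ Q z := fun z hz ↦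
    (hQ.differentiableOn two_ne_zero).differentiableAt (hOo.mem_nhds hz)
  have := fderiv_fiberScale (f := Q) (Λ := r ^ 2 • ContinuousLinearMap.id ℝ H) hr.ne' (hdQ z hz)
    (hdQ (fiberScale E r z) ⟨hz.1, smul_ne_zero hr.ne' hz.2⟩) (by
      filter_upwards [hOo.mem_nhds hz] with y hy
      exact hom y.1 hy.1 y.2 r hr.le)
  rw [this]
  ext y <;> simp

/-- The second derivative of a positively `2`-homogeneous map at a scaled vector. -/
theorem fderiv_fderiv_homogeneous {Q : E × E → H} {U : Set E} (hU : IsOpen U)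
    (hQ : ContDiffOn ℝ 2 Q (U ×ˢ {0}ᶜ))
    (hom : ∀ x ∈ U, ∀ (v : E) (r : ℝ), 0 ≤ r → Q (x, r • v) = r ^ 2 • Q (x, v)) {r : ℝ}
    (hr : 0 < r) {z : E × E} (hz : z ∈ U ×ˢ ({0}ᶜ : Set E)) :
    fderiv ℝ (fderiv ℝ Q) (fiberScale E r z) =
      (r ^ 2 • (ContinuousLinearMap.compL ℝ (E × E) (E × E) H).flip (fiberScale E r⁻¹)) ∘L
        fderiv ℝ (fderiv ℝ Q) z ∘L fiberScale E r⁻¹ := by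
  have hOo : IsOpen (U ×ˢ ({0}ᶜ : Set E)) := hU.prod isOpen_compl_singleton
  have hdg : ∀ z ∈ U ×ˢ ({0}ᶜ : Set E), DifferentiableAt ℝ (fderiv ℝ Q) z := fun z hz ↦
    ((hQ.fderiv_of_isOpen hOo (m := 1) (by norm_num)).differentiableOn
      one_ne_zero).differentiableAt (hOo.mem_nhds hz)
  refine fderiv_fiberScale hr.ne' (hdg z hz)
    (hdg (fiberScale E r z) ⟨hz.1, smul_ne_zero hr.ne' hz.2⟩) ?_
  filter_upwards [hOo.mem_nhds hz] with y hy
  rw [fderiv_homogeneous hU hQ hom hr hy]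
  rfl

/-- A positively `2`-homogeneous (in the fibre) map that is `C^2` off the zero section has, near
any point of the zero section, a Lipschitz continuous derivative. -/
theorem exists_lipschitzOnWith_fderiv_of_homogeneous [FiniteDimensional ℝ E] {Q : E × E → H}
    {U : Set E} (hU : IsOpen U) {p : E} (hp : p ∈ U) (hQ : ContDiffOn ℝ 2 Q (U ×ˢ {0}ᶜ))
    (hom : ∀ x ∈ U, ∀ (v : E) (r : ℝ), 0 ≤ r → Q (x, r • v) = r ^ 2 • Q (x, v)) :
    ∃ a : ℝ, 0 < a ∧ closedBall p a ⊆ U ∧ ∃ K : ℝ≥0,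
      (∀ z ∈ closedBall (p, (0 : E)) a, HasFDerivAt Q (fderiv ℝ Q z) z) ∧
      LipschitzOnWith K (fderiv ℝ Q) (closedBall (p, (0 : E)) a) := by
  obtain ⟨ρ, hρ0, hρ⟩ := nhds_basis_closedBall.mem_iff.mp (hU.mem_nhds hp)
  set a : ℝ := min (ρ / 2) 1 with ha
  have ha0 : 0 < a := by positivity
  have haρ : a ≤ ρ / 2 := min_le_left _ _
  have ha1 : a ≤ 1 := min_le_right _ _
  set O : Set (E × E) := U ×ˢ {0}ᶜ with hO
  have hOo : IsOpen O := hU.prod isOpen_compl_singleton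
  set g : E × E → E × E →L[ℝ] H := fderiv ℝ Q with hg
  have hg1 : ContDiffOn ℝ 1 g O := hQ.fderiv_of_isOpen hOo (by norm_num)
  have hg2 : ContinuousOn (fderiv ℝ g) O := hg1.continuousOn_fderiv_of_isOpen hOo le_rfl
  have hdQ : ∀ z ∈ O, DifferentiableAt ℝ Q z := fun z hz ↦
    (hQ.differentiableOn two_ne_zero).differentiableAt (hOo.mem_nhds hz)
  have hdg : ∀ z ∈ O, DifferentiableAt ℝ g z := fun z hz ↦
    (hg1.differentiableOn one_ne_zero).differentiableAt (hOo.mem_nhds hz)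
  have hgs : ∀ r : ℝ, 0 < r → ∀ z ∈ O,
      g (fiberScale E r z) = r ^ 2 • (g z ∘L fiberScale E r⁻¹) := fun r hr z hz ↦
    fderiv_homogeneous hU hQ hom hr hz
  set Λ : ℝ → (E × E →L[ℝ] H) →L[ℝ] (E × E →L[ℝ] H) := fun r ↦
    r ^ 2 • (ContinuousLinearMap.compL ℝ (E × E) (E × E) H).flip (fiberScale E r⁻¹) with hΛ
  have hgg : ∀ r : ℝ, 0 < r → ∀ z ∈ O,
      fderiv ℝ g (fiberScale E r z) = Λ r ∘L fderiv ℝ g z ∘L fiberScale E r⁻¹ := fun r hr z hz ↦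
    fderiv_fderiv_homogeneous hU hQ hom hr hz
  -- Finite dimension enters here: all bounds are taken on unit vectors and carried to `v` by
  -- scaling with `‖v‖`.
  have hS : IsCompact (closedBall p ρ ×ˢ sphere (0 : E) 1) :=
    (isCompact_closedBall p ρ).prod (isCompact_sphere 0 1)
  have hSO : closedBall p ρ ×ˢ sphere (0 : E) 1 ⊆ O := fun z hz ↦
    ⟨hρ hz.1, ne_of_mem_sphere hz.2 one_ne_zero⟩
  obtain ⟨M0, hM0⟩ := hS.exists_bound_of_continuousOn (hQ.continuousOn.mono hSO)
  obtain ⟨M1, hM1⟩ := hS.exists_bound_of_continuousOn (hg1.continuousOn.mono hSO)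
  obtain ⟨M2, hM2⟩ := hS.exists_bound_of_continuousOn
    (E := E × E →L[ℝ] E × E →L[ℝ] H) (f := fderiv ℝ g) (hg2.mono hSO)
  have hunit : ∀ x ∈ closedBall p ρ, ∀ v : E, v ≠ 0 →
      (x, ‖v‖⁻¹ • v) ∈ closedBall p ρ ×ˢ sphere (0 : E) 1 ∧
        fiberScale E ‖v‖ (x, ‖v‖⁻¹ • v) = (x, v) := by
    intro x hx v hv
    refine ⟨⟨hx, ?_⟩, ?_⟩
    · simp [norm_smul, hv]
    · simp [smul_smul, hv]
  have b0 : ∀ x ∈ closedBall p ρ, ∀ v : E, ‖Q (x, v)‖ ≤ M0 * ‖v‖ ^ 2 := by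
    intro x hx v
    by_cases hv : v = 0
    · have := hom x (hρ hx) 0 0 le_rfl
      simp only [smul_zero, ne_eq, two_ne_zero, not_false_eq_true, zero_pow, zero_smul] at this
      rw [hv, this]
      simp
    · obtain ⟨h1, h2⟩ := hunit x hx v hv
      have := hom x (hρ hx) (‖v‖⁻¹ • v) ‖v‖ (norm_nonneg _)
      rw [smul_smul, mul_inv_cancel₀ (norm_ne_zero_iff.mpr hv), one_smul] at this
      rw [this, norm_smul, mul_comm, Real.norm_of_nonneg (by positivity)]
      gcongr
      exact hM0 _ h1
  have hinv : ∀ v : E, v ≠ 0 → ‖v‖ ≤ 1 → ‖fiberScale E ‖v‖⁻¹‖ ≤ ‖v‖⁻¹ := fun v hv hv1 ↦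
    norm_fiberScale_le ((one_le_inv₀ (norm_pos_iff.mpr hv)).mpr hv1)
  have b1 : ∀ x ∈ closedBall p ρ, ∀ v : E, v ≠ 0 → ‖v‖ ≤ 1 → ‖g (x, v)‖ ≤ M1 * ‖v‖ := by
    intro x hx v hv hv1
    obtain ⟨h1, h2⟩ := hunit x hx v hv
    have hv0 : 0 < ‖v‖ := norm_pos_iff.mpr hv
    rw [← h2, hgs _ hv0 _ (hSO h1), norm_smul, Real.norm_of_nonneg (by positivity)]
    have h3 : ‖g (x, ‖v‖⁻¹ • v) ∘L fiberScale E ‖v‖⁻¹‖ ≤ M1 * ‖v‖⁻¹ :=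
      (ContinuousLinearMap.opNorm_comp_le _ _).trans (mul_le_mul (hM1 _ h1) (hinv v hv hv1)
        (norm_nonneg _) ((norm_nonneg _).trans (hM1 _ h1)))
    calc ‖v‖ ^ 2 * _ ≤ ‖v‖ ^ 2 * (M1 * ‖v‖⁻¹) := by gcongr
      _ = M1 * ‖v‖ := by field_simp
  -- The factor `‖v‖ ^ 2` absorbs the two inverse scalings, one per differentiation; each has norm
  -- at most `‖v‖⁻¹` because `‖v‖ ≤ 1`.
  have b2 : ∀ x ∈ closedBall p ρ, ∀ v : E, v ≠ 0 → ‖v‖ ≤ 1 → ‖fderiv ℝ g (x, v)‖ ≤ M2 := by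
    intro x hx v hv hv1
    obtain ⟨h1, h2⟩ := hunit x hx v hv
    have hv0 : 0 < ‖v‖ := norm_pos_iff.mpr hv
    have hM20 : 0 ≤ M2 := (norm_nonneg _).trans (hM2 _ h1)
    rw [← h2, hgg _ hv0 _ (hSO h1)]
    have h3 : ‖Λ ‖v‖‖ ≤ ‖v‖ := by
      refine ContinuousLinearMap.opNorm_le_bound _ hv0.le fun A ↦ ?_
      have : ‖A ∘L fiberScale E ‖v‖⁻¹‖ ≤ ‖A‖ * ‖v‖⁻¹ :=
        (ContinuousLinearMap.opNorm_comp_le _ _).trans (by gcongr; exact hinv v hv hv1)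
      change ‖‖v‖ ^ 2 • (A ∘L fiberScale E ‖v‖⁻¹)‖ ≤ _
      rw [norm_smul, Real.norm_of_nonneg (by positivity)]
      calc ‖v‖ ^ 2 * _ ≤ ‖v‖ ^ 2 * (‖A‖ * ‖v‖⁻¹) := by gcongr
        _ = ‖v‖ * ‖A‖ := by field_simp
    calc _ ≤ ‖Λ ‖v‖‖ * ‖fderiv ℝ g (x, ‖v‖⁻¹ • v) ∘L fiberScale E ‖v‖⁻¹‖ :=
          ContinuousLinearMap.opNorm_comp_le _ _
      _ ≤ ‖v‖ * (M2 * ‖v‖⁻¹) := by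
          gcongr
          exact (ContinuousLinearMap.opNorm_comp_le _ _).trans (mul_le_mul (hM2 _ h1)
            (hinv v hv hv1) (norm_nonneg _) hM20)
      _ = M2 := by field_simp
  have hzero : ∀ x ∈ closedBall p a, HasFDerivAt Q (0 : E × E →L[ℝ] H) (x, 0) := by
    intro x hx
    have hx0 : Q (x, 0) = 0 := by
      have := b0 x (closedBall_subset_closedBall (by linarith) hx) 0
      simpa using this
    rw [hasFDerivAt_iff_isLittleO]
    refine Asymptotics.IsBigO.trans_isLittleO (g := fun z ↦ ‖z - (x, (0 : E))‖ ^ 2) ?_ ?_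
    · refine Asymptotics.IsBigO.of_bound |M0| ?_
      have hev : ∀ᶠ z : E × E in 𝓝 (x, 0), z.1 ∈ ball p ρ := by
        refine continuous_fst.continuousAt.eventually_mem (isOpen_ball.mem_nhds ?_)
        exact closedBall_subset_ball (by linarith) hx
      filter_upwards [hev] with z hz
      have h1 := b0 z.1 (ball_subset_closedBall hz) z.2
      have h2 : ‖z.2‖ ≤ ‖z - (x, (0 : E))‖ := by
        have := norm_snd_le (z - (x, (0 : E)))
        simpa using this
      simp only [hx0, sub_zero, _root_.zero_apply, norm_pow, norm_norm]
      calc ‖Q z‖ ≤ M0 * ‖z.2‖ ^ 2 := h1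
        _ ≤ |M0| * ‖z.2‖ ^ 2 := by gcongr; exact le_abs_self _
        _ ≤ _ := by gcongr
    · have := (Asymptotics.isLittleO_norm_pow_id (E' := E × E) one_lt_two).comp_tendsto
        (tendsto_sub_nhds_zero_iff.mpr (tendsto_id (α := E × E) (x := 𝓝 (x, 0))))
      exact this
  have hmem : ∀ z ∈ closedBall (p, (0 : E)) a, z.1 ∈ closedBall p a ∧ ‖z.2‖ ≤ 1 := by
    intro z hz
    rw [← closedBall_prod_same] at hz
    exact ⟨hz.1, (mem_closedBall_zero_iff.mp hz.2).trans ha1⟩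
  have hsub : closedBall p a ⊆ closedBall p ρ := closedBall_subset_closedBall (by linarith)
  have b1' : ∀ z ∈ closedBall (p, (0 : E)) a, ‖g z‖ ≤ |M1| * ‖z.2‖ := by
    rintro ⟨x, v⟩ hz
    obtain ⟨h1, h2⟩ := hmem _ hz
    by_cases hv : v = 0
    · subst hv
      simp [hg, (hzero x h1).fderiv]
    · refine (b1 x (hsub h1) v hv h2).trans ?_
      gcongr
      exact le_abs_self _
  refine ⟨a, ha0, hsub.trans hρ, .mk (|M1| + |M2|) (by positivity), ?_, ?_⟩
  · rintro ⟨x, v⟩ hz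
    by_cases hv : v = 0
    · subst hv
      rw [hg, (hzero x (hmem _ hz).1).fderiv]
      exact hzero x (hmem _ hz).1
    · exact (hdQ _ ⟨hρ (hsub (hmem _ hz).1), hv⟩).hasFDerivAt
  · refine LipschitzOnWith.of_dist_le_mul fun z hz z' hz' ↦ ?_
    rw [dist_eq_norm, dist_eq_norm, NNReal.coe_mk]
    have hd : ‖z.2 - z'.2‖ ≤ ‖z - z'‖ := norm_snd_le (z - z')
    -- If the fibre segment passes through zero, then `‖z.2‖ + ‖z'.2‖ = ‖z.2 - z'.2‖`, and the
    -- linear bound on `g` suffices. Otherwise the segment avoids the zero section and the mean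
    -- value inequality applies.
    by_cases h0 : (0 : E) ∈ segment ℝ z.2 z'.2
    · have h1 := dist_add_dist_of_mem_segment h0
      rw [dist_zero_right, dist_zero_left, dist_eq_norm] at h1
      calc ‖g z - g z'‖ ≤ ‖g z‖ + ‖g z'‖ := norm_sub_le _ _
        _ ≤ |M1| * ‖z.2‖ + |M1| * ‖z'.2‖ := add_le_add (b1' z hz) (b1' z' hz')
        _ = |M1| * ‖z.2 - z'.2‖ := by rw [← mul_add, h1]
        _ ≤ (|M1| + |M2|) * ‖z - z'‖ := by
          gcongr
          linarith [abs_nonneg M2]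
    · have hin : ∀ y ∈ segment ℝ z' z, y ∈ O ∧ ‖fderiv ℝ g y‖ ≤ |M2| := by
        rintro ⟨x, v⟩ hy
        have hyB := (convex_closedBall (p, (0 : E)) a).segment_subset hz' hz hy
        have hv : v ≠ 0 := by
          rintro rfl
          rw [segment_symm] at hy
          exact h0 (Prod.segment_subset _ _ hy).2
        refine ⟨⟨hρ (hsub (hmem _ hyB).1), hv⟩, ?_⟩
        exact (b2 x (hsub (hmem _ hyB).1) v hv (hmem _ hyB).2).trans (le_abs_self _)
      have := (convex_segment z' z).norm_image_sub_le_of_norm_hasFDerivWithin_le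
        (fun y hy ↦ (hdg y (hin y hy).1).hasFDerivAt.hasFDerivWithinAt)
        (fun y hy ↦ (hin y hy).2) (left_mem_segment ℝ z' z) (right_mem_segment ℝ z' z)
      refine this.trans ?_
      gcongr
      linarith [abs_nonneg M1]

end Homogeneous

/-! ### The spray of a Lagrangian and the Euler-Lagrange equation -/

section Lagrangian

variable {E : Type*} [NormedAddCommGroup E] [NormedSpace ℝ E]

open ContinuousLinearMap (inl inr)

/-- The fibre Hessian of a Lagrangian `L(x, v)`. -/
noncomputable def fiberHessian (L : E × E → ℝ) (z : E × E) : E →L[ℝ] E →L[ℝ] ℝ :=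
  ((ContinuousLinearMap.compL ℝ E (E × E) ℝ).flip (inr ℝ E E)) ∘L
    fderiv ℝ (fderiv ℝ L) z ∘L inr ℝ E E

/-- The right hand side `∂L/∂x - ∂²L/∂x∂v · v` of the Euler-Lagrange equation solved for the
acceleration term. -/
noncomputable def lagrangianForce (L : E × E → ℝ) (z : E × E) : E →L[ℝ] ℝ :=
  fderiv ℝ L z ∘L inl ℝ E E - fderiv ℝ (fderiv ℝ L) z (z.2, 0) ∘L inr ℝ E E

open Classical in
/-- The spray of a Lagrangian: the acceleration prescribed by the Euler-Lagrange equation, extended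
by zero to the zero section. -/
noncomputable def lagrangianSpray (L : E × E → ℝ) (z : E × E) : E :=
  if z.2 = 0 then 0 else (fiberHessian L z).inverse (lagrangianForce L z)

@[simp] theorem fiberHessian_apply (L : E × E → ℝ) (z : E × E) (u w : E) :
    fiberHessian L z u w = fderiv ℝ (fderiv ℝ L) z (0, u) (0, w) := rfl

/-- Positive definiteness gives injectivity, and `E` and its dual have equal dimension. -/
theorem isInvertible_fiberHessian [FiniteDimensional ℝ E] {L : E × E → ℝ} {z : E × E}
    (hpos : ∀ u : E, u ≠ 0 → 0 < fderiv ℝ (fderiv ℝ L) z (0, u) (0, u)) :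
    (fiberHessian L z).IsInvertible := by
  have hinj : Function.Injective (fiberHessian L z : E →ₗ[ℝ] E →L[ℝ] ℝ) := by
    rw [← LinearMap.ker_eq_bot, LinearMap.ker_eq_bot']
    intro u hu
    by_contra hne
    have h1 := hpos u hne
    have h2 : fiberHessian L z u u = 0 := by
      have : fiberHessian L z u = 0 := hu
      rw [this]; rfl
    rw [fiberHessian_apply] at h2
    exact h1.ne' h2
  have hdim : Module.finrank ℝ E = Module.finrank ℝ (E →L[ℝ] ℝ) := by
    rw [← (LinearMap.toContinuousLinearMap : (E →ₗ[ℝ] ℝ) ≃ₗ[ℝ] E →L[ℝ] ℝ).finrank_eq]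
    exact (Subspace.dual_finrank_eq (K := ℝ) (V := E)).symm
  refine ⟨(LinearMap.linearEquivOfInjective _ hinj hdim).toContinuousLinearEquiv, ?_⟩
  ext u w
  rfl

variable {L : E × E → ℝ} {U : Set E}

theorem contDiffOn_lagrangianSpray [FiniteDimensional ℝ E] (hU : IsOpen U)
    (hL : ContDiffOn ℝ ∞ L (U ×ˢ {0}ᶜ))
    (hpos : ∀ z ∈ U ×ˢ ({0}ᶜ : Set E), ∀ u : E, u ≠ 0 →
      0 < fderiv ℝ (fderiv ℝ L) z (0, u) (0, u)) :
    ContDiffOn ℝ ∞ (lagrangianSpray L) (U ×ˢ {0}ᶜ) := by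
  have : CompleteSpace E := FiniteDimensional.complete ℝ E
  have hOo : IsOpen (U ×ˢ ({0}ᶜ : Set E)) := hU.prod isOpen_compl_singleton
  have h1 : ContDiffOn ℝ ∞ (fderiv ℝ L) (U ×ˢ {0}ᶜ) := hL.fderiv_of_isOpen hOo (by simp)
  have h2 : ContDiffOn ℝ ∞ (fderiv ℝ (fderiv ℝ L)) (U ×ˢ {0}ᶜ) := h1.fderiv_of_isOpen hOo (by simp)
  have hH : ContDiffOn ℝ ∞ (fiberHessian L) (U ×ˢ {0}ᶜ) :=
    contDiffOn_const.clm_comp (h2.clm_comp contDiffOn_const)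
  have hB : ContDiffOn ℝ ∞ (lagrangianForce L) (U ×ˢ {0}ᶜ) :=
    (h1.clm_comp contDiffOn_const).sub
      ((h2.clm_apply (contDiffOn_snd.prodMk contDiffOn_const)).clm_comp contDiffOn_const)
  have hmain : ContDiffOn ℝ ∞ (fun z ↦ (fiberHessian L z).inverse (lagrangianForce L z))
      (U ×ˢ {0}ᶜ) := by
    refine ContDiffOn.clm_apply (fun z hz ↦ ?_) hB
    obtain ⟨e, he⟩ := isInvertible_fiberHessian (hpos z hz)
    have := contDiffAt_map_inverse (𝕜 := ℝ) (n := ∞) e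
    rw [he] at this
    exact this.comp_contDiffWithinAt z (hH z hz)
  refine hmain.congr fun z hz ↦ ?_
  rw [lagrangianSpray, if_neg (show z.2 ≠ 0 from hz.2)]

/-- The fibre Hessian is 0-homogeneous and the force 2-homogeneous. The extension by zero covers `v
= 0` and `r = 0`. -/
theorem lagrangianSpray_smul (hU : IsOpen U)
    (hL : ContDiffOn ℝ ∞ L (U ×ˢ {0}ᶜ))
    (hom : ∀ x ∈ U, ∀ (v : E) (r : ℝ), 0 ≤ r → L (x, r • v) = r ^ 2 • L (x, v))
    {x : E} (hx : x ∈ U) (v : E) {r : ℝ} (hr : 0 ≤ r) :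
    lagrangianSpray L (x, r • v) = r ^ 2 • lagrangianSpray L (x, v) := by
  by_cases hv : v = 0
  · simp [lagrangianSpray, hv]
  rcases hr.eq_or_lt with rfl | hr
  · simp [lagrangianSpray]
  have hz : (x, v) ∈ U ×ˢ ({0}ᶜ : Set E) := ⟨hx, hv⟩
  have hL2 : ContDiffOn ℝ 2 L (U ×ˢ {0}ᶜ) := hL.of_le ENat.LEInfty.out
  have e1 := fderiv_homogeneous hU hL2 hom hr hz
  have e2 := fderiv_fderiv_homogeneous hU hL2 hom hr hz
  rw [fiberScale_apply] at e1 e2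
  have hH : fiberHessian L (x, r • v) = fiberHessian L (x, v) := by
    ext u w
    have h0 : (0, r⁻¹ • u) = r⁻¹ • ((0, u) : E × E) := by simp
    have h0' : (0, r⁻¹ • w) = r⁻¹ • ((0, w) : E × E) := by simp
    simp only [fiberHessian_apply, e2]
    simp only [ContinuousLinearMap.comp_apply, _root_.smul_apply,
      ContinuousLinearMap.flip_apply, ContinuousLinearMap.compL_apply, fiberScale_apply, h0, h0',
      map_smul, smul_eq_mul]
    field_simp
  have hB : lagrangianForce L (x, r • v) = r ^ 2 • lagrangianForce L (x, v) := by
    ext w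
    have h0' : (0, r⁻¹ • w) = r⁻¹ • ((0, w) : E × E) := by simp
    have h1 : (r • v, (0 : E)) = r • (v, (0 : E)) := by simp
    simp only [lagrangianForce, e1, e2]
    simp only [ContinuousLinearMap.comp_apply, _root_.smul_apply, _root_.sub_apply,
      ContinuousLinearMap.flip_apply, ContinuousLinearMap.compL_apply, fiberScale_apply,
      ContinuousLinearMap.inl_apply, ContinuousLinearMap.inr_apply, smul_zero, h0', h1,
      map_smul, smul_eq_mul]
    field_simp
  rw [lagrangianSpray, lagrangianSpray, if_neg (smul_ne_zero hr.ne' hv), if_neg hv, hH, hB,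
    map_smul]

/-- The Euler-Lagrange equation is the second order equation of the spray. -/
theorem eulerLagrange_iff_spray [FiniteDimensional ℝ E] (hU : IsOpen U)
    (hL : ContDiffOn ℝ ∞ L (U ×ˢ {0}ᶜ))
    (hpos : ∀ z ∈ U ×ˢ ({0}ᶜ : Set E), ∀ u : E, u ≠ 0 →
      0 < fderiv ℝ (fderiv ℝ L) z (0, u) (0, u))
    {y y' : ℝ → E} {t : ℝ} {w : E} (hy : HasDerivAt y (y' t) t) (hy' : HasDerivAt y' w t)
    (ht : y t ∈ U) (ht' : y' t ≠ 0) :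
    HasDerivAt (fun s ↦ fderiv ℝ L (y s, y' s) ∘L inr ℝ E E)
      (fderiv ℝ L (y t, y' t) ∘L inl ℝ E E) t ↔ w = lagrangianSpray L (y t, y' t) := by
  have hOo : IsOpen (U ×ˢ ({0}ᶜ : Set E)) := hU.prod isOpen_compl_singleton
  have hz : (y t, y' t) ∈ U ×ˢ ({0}ᶜ : Set E) := ⟨ht, ht'⟩
  have h1 : HasFDerivAt (fderiv ℝ L) (fderiv ℝ (fderiv ℝ L) (y t, y' t)) (y t, y' t) :=
    ((hL.fderiv_of_isOpen hOo (m := 1) (by rw [one_add_one_eq_two]; exact ENat.LEInfty.out)).differentiableOn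
      one_ne_zero).differentiableAt (hOo.mem_nhds hz) |>.hasFDerivAt
  have h2 : HasDerivAt (fun s ↦ fderiv ℝ L (y s, y' s))
      (fderiv ℝ (fderiv ℝ L) (y t, y' t) (y' t, w)) t :=
    h1.comp_hasDerivAt t (hy.prodMk hy')
  have h3 : HasDerivAt (fun s ↦ fderiv ℝ L (y s, y' s) ∘L inr ℝ E E)
      (fderiv ℝ (fderiv ℝ L) (y t, y' t) (y' t, w) ∘L inr ℝ E E) t :=
    ((ContinuousLinearMap.compL ℝ E (E × E) ℝ).flip (inr ℝ E E)).hasFDerivAt.comp_hasDerivAt t h2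
  -- The acceleration enters only through the fibre Hessian, so the equation is linear in `w` and
  -- can be solved for it.
  have h4 : fderiv ℝ (fderiv ℝ L) (y t, y' t) (y' t, w) ∘L inr ℝ E E =
      fderiv ℝ (fderiv ℝ L) (y t, y' t) (y' t, 0) ∘L inr ℝ E E +
        fiberHessian L (y t, y' t) w := by
    ext u
    have : (y' t, w) = (y' t, (0 : E)) + (0, w) := by simp
    rw [this, map_add]
    rfl
  have hinv := isInvertible_fiberHessian (hpos _ hz)
  rw [lagrangianSpray, if_neg ht']
  constructor
  · intro h
    have h5 := h3.unique h
    rw [h4] at h5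
    have h6 : lagrangianForce L (y t, y' t) = fiberHessian L (y t, y' t) w := by
      rw [lagrangianForce, ← h5]
      simp
    rw [h6, hinv.inverse_apply_self]
  · intro h
    have h6 : fiberHessian L (y t, y' t) w = lagrangianForce L (y t, y' t) := by
      rw [h, hinv.self_apply_inverse]
    refine h3.congr_deriv ?_
    rw [h4, h6, lagrangianForce]
    simp

/-- The Euler-Lagrange equation is invariant under a change of coordinates `τ`. -/
theorem eulerLagrange_comp {L₁ L₂ : E × E → ℝ} {τ : E → E} {x x' : ℝ → E} {t : ℝ}
    (hτ : ContDiffAt ℝ 2 τ (x t)) (hx : HasDerivAt x (x' t) t) (hx' : ContinuousAt x' t)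
    (hL : ∀ᶠ z in 𝓝 (x t, x' t), L₁ z = L₂ (τ z.1, fderiv ℝ τ z.1 z.2))
    (hd : ∀ᶠ z in 𝓝 (τ (x t), fderiv ℝ τ (x t) (x' t)), DifferentiableAt ℝ L₂ z)
    (h : HasDerivAt (fun s ↦ fderiv ℝ L₂ (τ (x s), fderiv ℝ τ (x s) (x' s)) ∘L inr ℝ E E)
      (fderiv ℝ L₂ (τ (x t), fderiv ℝ τ (x t) (x' t)) ∘L inl ℝ E E) t) :
    HasDerivAt (fun s ↦ fderiv ℝ L₁ (x s, x' s) ∘L inr ℝ E E)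
      (fderiv ℝ L₁ (x t, x' t) ∘L inl ℝ E E) t := by
  set T : E × E → E × E := fun z ↦ (τ z.1, fderiv ℝ τ z.1 z.2) with hT
  have hτ1 : ContDiffAt ℝ 1 (fderiv ℝ τ) (x t) := hτ.fderiv_right (by norm_num)
  have hτe : ∀ᶠ a in 𝓝 (x t), DifferentiableAt ℝ τ a ∧ DifferentiableAt ℝ (fderiv ℝ τ) a := by
    filter_upwards [hτ.eventually (by simp), hτ1.eventually (by simp)] with a ha ha'
    exact ⟨ha.differentiableAt two_ne_zero, ha'.differentiableAt one_ne_zero⟩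
  have hTd : ∀ z : E × E, DifferentiableAt ℝ τ z.1 → DifferentiableAt ℝ (fderiv ℝ τ) z.1 →
      HasFDerivAt T ((fderiv ℝ τ z.1 ∘L ContinuousLinearMap.fst ℝ E E).prod
        (fderiv ℝ τ z.1 ∘L ContinuousLinearMap.snd ℝ E E +
          (fderiv ℝ (fderiv ℝ τ) z.1 ∘L ContinuousLinearMap.fst ℝ E E).flip z.2)) z := by
    intro z h1 h2
    exact (h1.hasFDerivAt.comp z hasFDerivAt_fst).prodMk
      ((h2.hasFDerivAt.comp z hasFDerivAt_fst).clm_apply hasFDerivAt_snd)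
  have hcont : ContinuousAt (fun s ↦ (x s, x' s)) t := hx.continuousAt.prodMk hx'
  have hTc : ContinuousAt T (x t, x' t) :=
    (hTd (x t, x' t) hτe.self_of_nhds.1 hτe.self_of_nhds.2).continuousAt
  have hfd : ∀ᶠ z in 𝓝 (x t, x' t), HasFDerivAt L₁ (fderiv ℝ L₂ (T z) ∘L
      ((fderiv ℝ τ z.1 ∘L ContinuousLinearMap.fst ℝ E E).prod
        (fderiv ℝ τ z.1 ∘L ContinuousLinearMap.snd ℝ E E +
          (fderiv ℝ (fderiv ℝ τ) z.1 ∘L ContinuousLinearMap.fst ℝ E E).flip z.2))) z := by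
    filter_upwards [hL.eventually_nhds, hTc.eventually hd,
      (continuousAt_fst (p := (x t, x' t))).eventually hτe] with z h1 h2 h3
    exact (h2.hasFDerivAt.comp z (hTd z h3.1 h3.2)).congr_of_eventuallyEq h1
  have hfd' := hcont.eventually hfd
  -- Momenta pull back by the derivative of `τ`.
  have e1 : (fun s ↦ fderiv ℝ L₁ (x s, x' s) ∘L inr ℝ E E) =ᶠ[𝓝 t]
      fun s ↦ (fderiv ℝ L₂ (T (x s, x' s)) ∘L inr ℝ E E) ∘L fderiv ℝ τ (x s) := by
    filter_upwards [hfd'] with s hs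
    rw [hs.fderiv]
    ext u
    simp
  have h2 : HasDerivAt (fun s ↦ fderiv ℝ τ (x s)) (fderiv ℝ (fderiv ℝ τ) (x t) (x' t)) t :=
    (hτ1.differentiableAt one_ne_zero).hasFDerivAt.comp_hasDerivAt t hx
  refine ((h.clm_comp h2).congr_of_eventuallyEq e1).congr_deriv ?_
  rw [hfd'.self_of_nhds.fderiv]
  -- Differentiating the pulled-back momentum produces `D²τ(x', u)`, the position derivative of `L₁`
  -- produces `D²τ(u, x')`; symmetry identifies them.
  have hsymm : IsSymmSndFDerivAt ℝ τ (x t) := hτ.isSymmSndFDerivAt (by simp)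
  ext u
  have e : (fderiv ℝ τ (x t) u, fderiv ℝ (fderiv ℝ τ) (x t) u (x' t)) =
      (fderiv ℝ τ (x t) u, (0 : E)) + (0, fderiv ℝ (fderiv ℝ τ) (x t) u (x' t)) := by simp
  simp only [hT, _root_.add_apply, ContinuousLinearMap.comp_apply, ContinuousLinearMap.inl_apply,
    ContinuousLinearMap.inr_apply, ContinuousLinearMap.prod_apply, ContinuousLinearMap.flip_apply,
    ContinuousLinearMap.coe_fst', ContinuousLinearMap.coe_snd', map_zero, zero_add]
  rw [e, map_add, hsymm.eq]

end Lagrangian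

/-! ### The Finsler energy in a chart -/

section Charts

variable {E : Type*} [NormedAddCommGroup E] [NormedSpace ℝ E]
  {N : Type*} [TopologicalSpace N] [ChartedSpace E N]

theorem tangentBundle_mk_eq {q q' : N} (h : q = q') {v v' : E} (hv : v = v') :
    (⟨q, v⟩ : TangentBundle 𝓘(ℝ, E) N) = ⟨q', v'⟩ := by
  subst h hv; rfl

theorem mdifferentiable_of_mem_maximalAtlas {e : OpenPartialHomeomorph N E}
    (he : e ∈ IsManifold.maximalAtlas 𝓘(ℝ, E) ∞ N) : e.MDifferentiable 𝓘(ℝ, E) 𝓘(ℝ, E) :=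
  ⟨(contMDiffOn_of_mem_maximalAtlas he).mdifferentiableOn (by simp),
    (contMDiffOn_symm_of_mem_maximalAtlas he).mdifferentiableOn (by simp)⟩

theorem contMDiff_tangentBundle_mk :
    ContMDiff 𝓘(ℝ, E × E) 𝓘(ℝ, E).tangent ∞
      (fun z : E × E ↦ (⟨z.1, z.2⟩ : TangentBundle 𝓘(ℝ, E) E)) := by
  have h := contMDiff_tangentBundleModelSpaceHomeomorph_symm (I := 𝓘(ℝ, E)) (n := ∞)
  rw [modelWithCornersSelf_prod]
  exact h

variable [IsManifold 𝓘(ℝ, E) ∞ N]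

/-- The energy Lagrangian `½ F²` in a chart, on the product `E × E`. -/
noncomputable def FinslerMetric.chartEnergy (F : FinslerMetric E N)
    (e : OpenPartialHomeomorph N E) (z : E × E) : ℝ :=
  F.chartLagrangian e z.1 z.2

variable (F : FinslerMetric E N) {e : OpenPartialHomeomorph N E}
  (he : e ∈ IsManifold.maximalAtlas 𝓘(ℝ, E) ∞ N)
include he

omit [IsManifold 𝓘(ℝ, E) ∞ N] in
theorem mfderiv_symm_ne_zero {x : E} (hx : x ∈ e.target) {v : E} (hv : v ≠ 0) :
    (mfderiv 𝓘(ℝ, E) 𝓘(ℝ, E) e.symm x v : E) ≠ 0 := by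
  intro h
  exact hv ((mdifferentiable_of_mem_maximalAtlas he).symm.mfderiv_injective hx
    (h.trans (map_zero (mfderiv 𝓘(ℝ, E) 𝓘(ℝ, E) e.symm x)).symm))

/-- The energy is `½F²` composed with the tangent map of `e.symm`, which is smooth and sends nonzero
vectors to nonzero vectors. -/
theorem FinslerMetric.contDiffOn_chartEnergy :
    ContDiffOn ℝ ∞ (F.chartEnergy e) (e.target ×ˢ {0}ᶜ) := by
  have h1 : ContMDiffOn 𝓘(ℝ, E).tangent 𝓘(ℝ, E).tangent ∞
      (tangentMapWithin 𝓘(ℝ, E) 𝓘(ℝ, E) e.symm e.target)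
      (Bundle.TotalSpace.proj ⁻¹' e.target) :=
    (contMDiffOn_symm_of_mem_maximalAtlas he).contMDiffOn_tangentMapWithin (by simp)
      e.open_target.uniqueMDiffOn
  have h2 := h1.comp (contMDiff_tangentBundle_mk (E := E)).contMDiffOn
    (s := e.target ×ˢ ({0}ᶜ : Set E)) (fun z hz ↦ hz.1)
  have h3 : ∀ z ∈ e.target ×ˢ ({0}ᶜ : Set E),
      (tangentMapWithin 𝓘(ℝ, E) 𝓘(ℝ, E) e.symm e.target ∘
        fun z : E × E ↦ (⟨z.1, z.2⟩ : TangentBundle 𝓘(ℝ, E) E)) z =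
      ⟨e.symm z.1, mfderiv 𝓘(ℝ, E) 𝓘(ℝ, E) e.symm z.1 z.2⟩ := by
    intro z hz
    refine tangentBundle_mk_eq rfl ?_
    change mfderivWithin 𝓘(ℝ, E) 𝓘(ℝ, E) e.symm e.target z.1 z.2 = _
    rw [mfderivWithin_of_isOpen e.open_target hz.1]
  have h4 := F.smooth.comp h2 (fun z hz ↦ by
    rw [mem_preimage, h3 z hz]
    exact mfderiv_symm_ne_zero he hz.1 hz.2)
  rw [← contMDiffOn_iff_contDiffOn]
  have h5 := h4.contDiffOn.pow 2 |>.div_const 2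
  rw [contMDiffOn_iff_contDiffOn]
  refine h5.congr fun z hz ↦ ?_
  rw [Function.comp_apply, h3 z hz]
  rfl

omit he in
theorem FinslerMetric.chartEnergy_smul (x v : E) {r : ℝ} (hr : 0 ≤ r) :
    F.chartEnergy e (x, r • v) = r ^ 2 • F.chartEnergy e (x, v) := by
  have h : (mfderiv 𝓘(ℝ, E) 𝓘(ℝ, E) e.symm x (r • v)) =
      r • (mfderiv 𝓘(ℝ, E) 𝓘(ℝ, E) e.symm x v) := map_smul _ _ _
  simp only [FinslerMetric.chartEnergy, FinslerMetric.chartLagrangian]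
  rw [h, F.homogeneous _ _ r hr, smul_eq_mul]
  ring

/-- The iterated `deriv` defining the fundamental tensor becomes a second Fréchet derivative along a
fibre line; the 2 in `F² = 2L` cancels the factor ½. -/
theorem FinslerMetric.chartEnergy_posDef {z : E × E} (hz : z ∈ e.target ×ˢ ({0}ᶜ : Set E)) {u : E}
    (hu : u ≠ 0) : 0 < fderiv ℝ (fderiv ℝ (F.chartEnergy e)) z (0, u) (0, u) := by
  have hOo : IsOpen (e.target ×ˢ ({0}ᶜ : Set E)) := e.open_target.prod isOpen_compl_singleton
  have hL := F.contDiffOn_chartEnergy he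
  have hd : ∀ y ∈ e.target ×ˢ ({0}ᶜ : Set E), DifferentiableAt ℝ (F.chartEnergy e) y := fun y hy ↦
    (hL.differentiableOn (by simp)).differentiableAt (hOo.mem_nhds hy)
  have hd2 : DifferentiableAt ℝ (fderiv ℝ (F.chartEnergy e)) z :=
    ((hL.fderiv_of_isOpen hOo (m := 1)
      (by rw [one_add_one_eq_two]; exact ENat.LEInfty.out)).differentiableOn
      one_ne_zero).differentiableAt (hOo.mem_nhds hz)
  have hpos := F.posDef (e.symm z.1) (mfderiv 𝓘(ℝ, E) 𝓘(ℝ, E) e.symm z.1 z.2)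
    (mfderiv 𝓘(ℝ, E) 𝓘(ℝ, E) e.symm z.1 u) (mfderiv_symm_ne_zero he hz.1 hz.2)
    (mfderiv_symm_ne_zero he hz.1 hu)
  have hF : ∀ s t : ℝ, F.toFun ⟨e.symm z.1, mfderiv 𝓘(ℝ, E) 𝓘(ℝ, E) e.symm z.1 z.2 +
      s • mfderiv 𝓘(ℝ, E) 𝓘(ℝ, E) e.symm z.1 u + t • mfderiv 𝓘(ℝ, E) 𝓘(ℝ, E) e.symm z.1 u⟩ ^ 2 =
      2 * F.chartEnergy e (z + s • (0, u) + t • (0, u)) := by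
    intro s t
    have h : mfderiv 𝓘(ℝ, E) 𝓘(ℝ, E) e.symm z.1 z.2 +
        s • mfderiv 𝓘(ℝ, E) 𝓘(ℝ, E) e.symm z.1 u + t • mfderiv 𝓘(ℝ, E) 𝓘(ℝ, E) e.symm z.1 u =
        mfderiv 𝓘(ℝ, E) 𝓘(ℝ, E) e.symm z.1 (z.2 + s • u + t • u) := by
      have hA : ∀ A : E →L[ℝ] E, A z.2 + s • A u + t • A u = A (z.2 + s • u + t • u) := by simp
      exact hA _
    rw [h]
    have h2 : z + s • ((0 : E), u) + t • ((0 : E), u) = (z.1, z.2 + s • u + t • u) := by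
      ext <;> simp
    rw [h2, FinslerMetric.chartEnergy, FinslerMetric.chartLagrangian]
    ring
  have hline : ∀ (w : E × E), HasDerivAt (fun t : ℝ ↦ w + t • ((0 : E), u)) (0, u) 0 := fun w ↦ by
    simpa using ((hasDerivAt_id (0 : ℝ)).smul_const ((0 : E), u)).const_add w
  have hinner : ∀ᶠ s : ℝ in 𝓝 0,
      deriv (fun t : ℝ ↦ 2 * F.chartEnergy e (z + s • (0, u) + t • (0, u))) 0 =
        2 * fderiv ℝ (F.chartEnergy e) (z + s • (0, u)) (0, u) := by
    have hev : ∀ᶠ s : ℝ in 𝓝 0, z + s • ((0 : E), u) ∈ e.target ×ˢ ({0}ᶜ : Set E) := by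
      refine (hline z).continuousAt.eventually_mem (hOo.mem_nhds ?_)
      simpa using hz
    filter_upwards [hev] with s hs
    have h1 : HasFDerivAt (F.chartEnergy e) (fderiv ℝ (F.chartEnergy e) (z + s • (0, u)))
        (z + s • (0, u) + (0 : ℝ) • (0, u)) := by
      rw [zero_smul, add_zero]
      exact (hd _ hs).hasFDerivAt
    exact ((h1.comp_hasDerivAt (0 : ℝ) (hline _)).const_mul 2).deriv
  set L := F.chartEnergy e
  have houter : HasDerivAt (fun s : ℝ ↦ 2 * fderiv ℝ L (z + s • (0, u)) (0, u))
      (2 * fderiv ℝ (fderiv ℝ L) z (0, u) (0, u)) 0 := by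
    have h1 : HasFDerivAt (fderiv ℝ L) (fderiv ℝ (fderiv ℝ L) z) (z + (0 : ℝ) • (0, u)) := by
      rw [zero_smul, add_zero]
      exact hd2.hasFDerivAt
    have h2 : HasDerivAt (fun s : ℝ ↦ fderiv ℝ L (z + s • (0, u)))
        (fderiv ℝ (fderiv ℝ L) z (0, u)) 0 := h1.comp_hasDerivAt (0 : ℝ) (hline z)
    have h3 := (ContinuousLinearMap.apply ℝ ℝ ((0 : E), u)).hasFDerivAt.comp_hasDerivAt (0 : ℝ) h2
    exact h3.const_mul 2
  have hval : finslerFundamentalTensor F.toFun (e.symm z.1)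
      (mfderiv 𝓘(ℝ, E) 𝓘(ℝ, E) e.symm z.1 z.2) (mfderiv 𝓘(ℝ, E) 𝓘(ℝ, E) e.symm z.1 u)
      (mfderiv 𝓘(ℝ, E) 𝓘(ℝ, E) e.symm z.1 u) =
      fderiv ℝ (fderiv ℝ (F.chartEnergy e)) z (0, u) (0, u) := by
    simp only [finslerFundamentalTensor]
    simp_rw [hF]
    rw [Filter.EventuallyEq.deriv_eq hinner, houter.deriv]
    ring
  rwa [hval] at hpos

end Charts

/-! ### Geodesics as integral curves of the geodesic field -/

section Curves

open ContinuousLinearMap (inl inr)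

variable {E : Type*} [NormedAddCommGroup E] [NormedSpace ℝ E]
  {N : Type*} [TopologicalSpace N] [ChartedSpace E N]

theorem hasDerivAt_chart_comp {e : OpenPartialHomeomorph N E}
    (he : e ∈ IsManifold.maximalAtlas 𝓘(ℝ, E) ∞ N) {γ : ℝ → N} {t : ℝ}
    (hγ : MDifferentiableAt 𝓘(ℝ, ℝ) 𝓘(ℝ, E) γ t) (ht : γ t ∈ e.source) :
    HasDerivAt (F := E) (e ∘ γ)
      (mfderiv 𝓘(ℝ, E) 𝓘(ℝ, E) e (γ t) (mfderiv 𝓘(ℝ, ℝ) 𝓘(ℝ, E) γ t (1 : ℝ)) : E) t := by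
  have h := ((mdifferentiable_of_mem_maximalAtlas he).mdifferentiableAt ht).hasMFDerivAt.comp t
    hγ.hasMFDerivAt
  let A : E →L[ℝ] E := mfderiv 𝓘(ℝ, E) 𝓘(ℝ, E) e (γ t)
  let B : ℝ →L[ℝ] E := mfderiv 𝓘(ℝ, ℝ) 𝓘(ℝ, E) γ t
  have h' : HasFDerivAt (e ∘ γ) (A ∘L B) t := hasMFDerivAt_iff_hasFDerivAt.mp h
  exact h'.hasDerivAt

theorem mfderiv_chart_symm_comp {e : OpenPartialHomeomorph N E}
    (he : e ∈ IsManifold.maximalAtlas 𝓘(ℝ, E) ∞ N) {y : ℝ → E} {t : ℝ} {v : E}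
    (hy : HasDerivAt y v t) (ht : y t ∈ e.target) :
    (mfderiv 𝓘(ℝ, ℝ) 𝓘(ℝ, E) (e.symm ∘ y) t (1 : ℝ) : E) =
      mfderiv 𝓘(ℝ, E) 𝓘(ℝ, E) e.symm (y t) v := by
  have hy' : HasMFDerivAt 𝓘(ℝ, ℝ) 𝓘(ℝ, E) y t (ContinuousLinearMap.toSpanSingleton ℝ v) :=
    hasMFDerivAt_iff_hasFDerivAt.mpr hy.hasFDerivAt
  have h := ((mdifferentiable_of_mem_maximalAtlas he).mdifferentiableAt_symm ht).hasMFDerivAt.comp t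
    hy'
  rw [h.mfderiv]
  change mfderiv 𝓘(ℝ, E) 𝓘(ℝ, E) e.symm (y t) ((1 : ℝ) • v) = _
  rw [one_smul]

theorem contDiffAt_chart_comp [IsManifold 𝓘(ℝ, E) ∞ N] {e : OpenPartialHomeomorph N E}
    (he : e ∈ IsManifold.maximalAtlas 𝓘(ℝ, E) ∞ N) {γ : ℝ → N} {t : ℝ}
    (hγ : ContMDiffAt 𝓘(ℝ, ℝ) 𝓘(ℝ, E) 2 γ t) (ht : γ t ∈ e.source) :
    ContDiffAt ℝ 2 (e ∘ γ) t := by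
  rw [← contMDiffAt_iff_contDiffAt]
  exact ((contMDiffAt_of_mem_maximalAtlas he ht).of_le ENat.LEInfty.out).comp t hγ

theorem contDiffAt_transition [IsManifold 𝓘(ℝ, E) ∞ N] {e φ : OpenPartialHomeomorph N E}
    (he : e ∈ IsManifold.maximalAtlas 𝓘(ℝ, E) ∞ N) (hφ : φ ∈ IsManifold.maximalAtlas 𝓘(ℝ, E) ∞ N)
    {x : E} (hx : x ∈ e.target) (hx' : e.symm x ∈ φ.source) :
    ContDiffAt ℝ ∞ (φ ∘ e.symm) x := by
  rw [← contMDiffAt_iff_contDiffAt]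
  exact (contMDiffAt_of_mem_maximalAtlas hφ hx').comp x
    (contMDiffAt_symm_of_mem_maximalAtlas he hx)

namespace FinslerMetric

variable [IsManifold 𝓘(ℝ, E) ∞ N] (F : FinslerMetric E N)

theorem differentiableAt_chartEnergy {e : OpenPartialHomeomorph N E}
    (he : e ∈ IsManifold.maximalAtlas 𝓘(ℝ, E) ∞ N) {z : E × E} (hz : z.1 ∈ e.target)
    (hz' : z.2 ≠ 0) : DifferentiableAt ℝ (F.chartEnergy e) z :=
  ((F.contDiffOn_chartEnergy he).differentiableOn (by simp)).differentiableAt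
    ((e.open_target.prod isOpen_compl_singleton).mem_nhds ⟨hz, hz'⟩)

/-- Partial derivatives are restrictions of the total one wherever the energy is differentiable.
This is known only off the zero section, hence the velocity condition near `t`. -/
theorem eulerLagrangeAt_iff {e : OpenPartialHomeomorph N E}
    (he : e ∈ IsManifold.maximalAtlas 𝓘(ℝ, E) ∞ N) {γ : ℝ → N} {t : ℝ}
    (h : ∀ᶠ s in 𝓝 t, γ s ∈ e.source ∧ deriv (e ∘ γ) s ≠ 0) :
    F.EulerLagrangeAt e γ t ↔
      HasDerivAt (fun s ↦ fderiv ℝ (F.chartEnergy e) (e (γ s), deriv (e ∘ γ) s) ∘L inr ℝ E E)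
        (fderiv ℝ (F.chartEnergy e) (e (γ t), deriv (e ∘ γ) t) ∘L inl ℝ E E) t := by
  have h1 : (fun s => fderiv ℝ (fun v => F.chartLagrangian e (e (γ s)) v) (deriv (e ∘ γ) s))
      =ᶠ[𝓝 t]
      fun s ↦ fderiv ℝ (F.chartEnergy e) (e (γ s), deriv (e ∘ γ) s) ∘L inr ℝ E E := by
    filter_upwards [h] with s hs
    have hd := F.differentiableAt_chartEnergy he (z := (e (γ s), deriv (e ∘ γ) s))
      (e.map_source hs.1) hs.2
    exact (hd.hasFDerivAt.comp (deriv (e ∘ γ) s)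
      (hasFDerivAt_prodMk_right (𝕜 := ℝ) (e (γ s)) (deriv (e ∘ γ) s))).fderiv
  have h2 : fderiv ℝ (fun x => F.chartLagrangian e x (deriv (e ∘ γ) t)) (e (γ t)) =
      fderiv ℝ (F.chartEnergy e) (e (γ t), deriv (e ∘ γ) t) ∘L inl ℝ E E := by
    obtain ⟨hs, hs'⟩ := h.self_of_nhds
    have hd := F.differentiableAt_chartEnergy he (z := (e (γ t), deriv (e ∘ γ) t))
      (e.map_source hs) hs'
    exact (hd.hasFDerivAt.comp (e (γ t))
      (hasFDerivAt_prodMk_left (𝕜 := ℝ) (e (γ t)) (deriv (e ∘ γ) t))).fderiv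
  rw [FinslerMetric.EulerLagrangeAt, h2]
  exact h1.hasDerivAt_iff

/-- Near `x`, `e.symm = φ.symm ∘ (φ ∘ e.symm)`; by the chain rule both sides evaluate `F` at the
same tangent vector. -/
theorem chartEnergy_transition {e φ : OpenPartialHomeomorph N E}
    (he : e ∈ IsManifold.maximalAtlas 𝓘(ℝ, E) ∞ N) (hφ : φ ∈ IsManifold.maximalAtlas 𝓘(ℝ, E) ∞ N)
    {x : E} (hx : x ∈ e.target) (hx' : e.symm x ∈ φ.source) (v : E) :
    F.chartEnergy e (x, v) =
      F.chartEnergy φ ((φ ∘ e.symm) x, fderiv ℝ (φ ∘ e.symm) x v) := by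
  have h1 : φ.symm ((φ ∘ e.symm) x) = e.symm x := φ.left_inv hx'
  have hτ : HasMFDerivAt 𝓘(ℝ, E) 𝓘(ℝ, E) (φ ∘ e.symm) x (fderiv ℝ (φ ∘ e.symm) x) :=
    hasMFDerivAt_iff_hasFDerivAt.mpr
      ((contDiffAt_transition he hφ hx hx').differentiableAt (by simp)).hasFDerivAt
  have h2 : HasMFDerivAt 𝓘(ℝ, E) 𝓘(ℝ, E) (φ.symm ∘ φ ∘ e.symm) x _ :=
    (((mdifferentiable_of_mem_maximalAtlas hφ).mdifferentiableAt_symm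
      (φ.map_source hx')).hasMFDerivAt).comp x hτ
  have h3 : e.symm =ᶠ[𝓝 x] φ.symm ∘ φ ∘ e.symm := by
    have hc : ContinuousAt e.symm x := e.continuousAt_symm hx
    filter_upwards [hc.eventually_mem (φ.open_source.mem_nhds hx')] with a ha
    exact (φ.left_inv ha).symm
  have h4 := (h2.congr_of_eventuallyEq h3).mfderiv
  have h5 : (mfderiv 𝓘(ℝ, E) 𝓘(ℝ, E) e.symm x v : E) =
      mfderiv 𝓘(ℝ, E) 𝓘(ℝ, E) φ.symm ((φ ∘ e.symm) x) (fderiv ℝ (φ ∘ e.symm) x v) := by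
    rw [h4]; rfl
  have h6 := tangentBundle_mk_eq (E := E) h1.symm (v := mfderiv 𝓘(ℝ, E) 𝓘(ℝ, E) e.symm x v)
    (v' := mfderiv 𝓘(ℝ, E) 𝓘(ℝ, E) φ.symm ((φ ∘ e.symm) x) (fderiv ℝ (φ ∘ e.symm) x v)) h5
  exact congrArg (fun w ↦ F.toFun w ^ 2 / 2) h6

/-- The geodesic vector field of `F` in the chart `φ`. -/
noncomputable def geodesicField (φ : OpenPartialHomeomorph N E) (z : E × E) : E × E :=
  (z.2, lagrangianSpray (F.chartEnergy φ) z)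

variable [FiniteDimensional ℝ E] {φ : OpenPartialHomeomorph N E}
  (hφ : φ ∈ IsManifold.maximalAtlas 𝓘(ℝ, E) ∞ N)
include hφ

/-- Geodesics are integral curves of the geodesic field. -/
theorem hasDerivAt_of_eulerLagrangeAt {γ : ℝ → N} {t : ℝ}
    (hγ : ContMDiffAt 𝓘(ℝ, ℝ) 𝓘(ℝ, E) 2 γ t) (ht : γ t ∈ φ.source)
    (hv : (curveVelocity (E := E) γ t).2 ≠ 0) (hEL : F.EulerLagrangeAt φ γ t) :
    HasDerivAt (fun s ↦ (φ (γ s), deriv (φ ∘ γ) s))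
      (F.geodesicField φ (φ (γ t), deriv (φ ∘ γ) t)) t := by
  have hC := contDiffAt_chart_comp hφ hγ ht
  have h1 : HasDerivAt (φ ∘ γ) (deriv (φ ∘ γ) t) t :=
    (hC.differentiableAt two_ne_zero).hasDerivAt
  have hC1 : ContDiffAt ℝ 1 (deriv (φ ∘ γ)) t := by
    have := (hC.fderiv_right (m := 1) (by norm_num)).clm_apply (contDiffAt_const (c := (1 : ℝ)))
    simpa using this
  have h2 : HasDerivAt (deriv (φ ∘ γ)) (deriv (deriv (φ ∘ γ)) t) t :=
    (hC1.differentiableAt one_ne_zero).hasDerivAt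
  have hne : deriv (φ ∘ γ) t ≠ 0 := by
    rw [(hasDerivAt_chart_comp hφ (hγ.mdifferentiableAt two_ne_zero) ht).deriv]
    intro h
    exact hv ((mdifferentiable_of_mem_maximalAtlas hφ).mfderiv_injective ht
      (h.trans (map_zero (mfderiv 𝓘(ℝ, E) 𝓘(ℝ, E) φ (γ t))).symm))
  have hev : ∀ᶠ s in 𝓝 t, γ s ∈ φ.source ∧ deriv (φ ∘ γ) s ≠ 0 :=
    (hγ.continuousAt.eventually_mem (φ.open_source.mem_nhds ht)).and
      (hC1.continuousAt.eventually_ne hne)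
  rw [F.eulerLagrangeAt_iff hφ hev] at hEL
  have h3 := (eulerLagrange_iff_spray φ.open_target (F.contDiffOn_chartEnergy hφ)
    (fun z hz u hu ↦ F.chartEnergy_posDef hφ hz hu) h1 h2 (φ.map_source ht) hne).mp hEL
  refine (h1.prodMk h2).congr_deriv ?_
  rw [h3]
  rfl

/-- Integral curves of the geodesic field with nonzero velocity are geodesics. -/
theorem isGeodesicOn_of_hasDerivAt {J : Set ℝ} (hJ : IsOpen J) {y v : ℝ → E}
    (hy : ∀ s ∈ J, HasDerivAt y (v s) s)
    (hv : ∀ s ∈ J, HasDerivAt v (lagrangianSpray (F.chartEnergy φ) (y s, v s)) s)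
    (hmem : ∀ s ∈ J, y s ∈ φ.target) (hne : ∀ s ∈ J, v s ≠ 0) :
    F.IsGeodesicOn (φ.symm ∘ y) J := by
  have hvc : ContinuousOn v J := HasDerivAt.continuousOn hv
  have hyc : ContinuousOn y J := HasDerivAt.continuousOn hy
  have hQ := contDiffOn_lagrangianSpray φ.open_target (F.contDiffOn_chartEnergy hφ)
    (fun z hz u hu ↦ F.chartEnergy_posDef hφ hz hu)
  -- Bootstrapping: `v'` is the spray along a continuous curve, so `v` is `C¹` and `y` is `C²`.
  have hv1 : ContDiffOn ℝ 1 v J := by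
    rw [← zero_add 1, contDiffOn_succ_iff_deriv_of_isOpen hJ, contDiffOn_zero]
    refine ⟨fun s hs ↦ (hv s hs).differentiableAt.differentiableWithinAt, by simp, ?_⟩
    refine (hQ.continuousOn.comp (hyc.prodMk hvc) fun s hs ↦ ⟨hmem s hs, hne s hs⟩).congr ?_
    exact fun s hs ↦ (hv s hs).deriv
  have hy2 : ContDiffOn ℝ 2 y J := by
    rw [← one_add_one_eq_two, contDiffOn_succ_iff_deriv_of_isOpen hJ]
    exact ⟨fun s hs ↦ (hy s hs).differentiableAt.differentiableWithinAt, by simp,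
      hv1.congr fun s hs ↦ (hy s hs).deriv⟩
  have hγ : ContMDiffOn 𝓘(ℝ, ℝ) 𝓘(ℝ, E) 2 (φ.symm ∘ y) J :=
    ((contMDiffOn_symm_of_mem_maximalAtlas hφ).of_le ENat.LEInfty.out).comp
      hy2.contMDiffOn hmem
  refine ⟨hγ, Or.inr fun t ht ↦ ⟨?_, fun e he hte ↦ ?_⟩⟩
  · have h := mfderiv_symm_ne_zero hφ (hmem t ht) (hne t ht)
    rw [← mfderiv_chart_symm_comp hφ (hy t ht) (hmem t ht)] at h
    exact h
  · have hγt : ∀ s ∈ J, ContMDiffAt 𝓘(ℝ, ℝ) 𝓘(ℝ, E) 2 (φ.symm ∘ y) s := fun s hs ↦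
      (hγ s hs).contMDiffAt (hJ.mem_nhds hs)
    set x : ℝ → E := e ∘ φ.symm ∘ y with hx
    have hC : ContDiffAt ℝ 2 x t := contDiffAt_chart_comp he (hγt t ht) hte
    have hC1 : ContDiffAt ℝ 1 (deriv x) t := by
      have := (hC.fderiv_right (m := 1) (by norm_num)).clm_apply (contDiffAt_const (c := (1 : ℝ)))
      simpa using this
    -- The equation holds in `φ`; the transition map carries it to the arbitrary chart `e`.
    set τ : E → E := φ ∘ e.symm with hτ
    have hxy : ∀ s ∈ J, (φ.symm ∘ y) s ∈ e.source → x s ∈ e.target ∧ e.symm (x s) ∈ φ.source ∧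
        τ (x s) = y s := by
      intro s hs hse
      have h1 : e.symm (x s) = φ.symm (y s) := e.left_inv hse
      refine ⟨e.map_source hse, ?_, ?_⟩
      · rw [h1]; exact φ.map_target (hmem s hs)
      · rw [hτ, Function.comp_apply, h1, φ.right_inv (hmem s hs)]
    have hse : ∀ᶠ s in 𝓝 t, s ∈ J ∧ (φ.symm ∘ y) s ∈ e.source :=
      (hJ.eventually_mem ht).and
        ((hγt t ht).continuousAt.eventually_mem (e.open_source.mem_nhds hte))
    have hv' : ∀ᶠ s in 𝓝 t, fderiv ℝ τ (x s) (deriv x s) = v s := by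
      filter_upwards [hse.eventually_nhds] with s hs
      obtain ⟨hsJ, hs2⟩ := hs.self_of_nhds
      obtain ⟨a1, a2, a3⟩ := hxy s hsJ hs2
      have b1 : HasDerivAt (τ ∘ x) (fderiv ℝ τ (x s) (deriv x s)) s :=
        ((contDiffAt_transition he hφ a1 a2).differentiableAt (by simp)).hasFDerivAt.comp_hasDerivAt
          s ((contDiffAt_chart_comp he (hγt s hsJ) hs2).differentiableAt two_ne_zero).hasDerivAt
      refine (b1.congr_of_eventuallyEq ?_).unique (hy s hsJ)
      filter_upwards [hs] with r hr
      exact (hxy r hr.1 hr.2).2.2.symm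
    have hne' : ∀ᶠ s in 𝓝 t, (φ.symm ∘ y) s ∈ e.source ∧ deriv x s ≠ 0 := by
      filter_upwards [hse, hv'] with s hs hs'
      refine ⟨hs.2, fun h0 ↦ hne s hs.1 ?_⟩
      rw [← hs', h0, map_zero]
    rw [F.eulerLagrangeAt_iff he hne']
    obtain ⟨a1, a2, a3⟩ := hxy t ht hte
    have hvt := hv'.self_of_nhds
    refine eulerLagrange_comp (L₂ := F.chartEnergy φ) (τ := τ) (x := x)
      ((contDiffAt_transition he hφ a1 a2).of_le ENat.LEInfty.out)
      (hC.differentiableAt two_ne_zero).hasDerivAt hC1.continuousAt ?_ ?_ ?_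
    · have hev : ∀ᶠ a in 𝓝 (x t), a ∈ e.target ∧ e.symm a ∈ φ.source :=
        (e.open_target.eventually_mem a1).and
          ((e.continuousAt_symm a1).eventually_mem (φ.open_source.mem_nhds a2))
      filter_upwards [(continuousAt_fst (p := (x t, deriv x t))).eventually hev] with z hz
      exact F.chartEnergy_transition he hφ hz.1 hz.2 z.2
    · rw [hvt, a3]
      filter_upwards [(φ.open_target.prod isOpen_compl_singleton).mem_nhds
        (show (y t, v t) ∈ φ.target ×ˢ ({0}ᶜ : Set E) from ⟨hmem t ht, hne t ht⟩)] with z hz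
      exact F.differentiableAt_chartEnergy hφ hz.1 hz.2
    · have h := (eulerLagrange_iff_spray φ.open_target (F.contDiffOn_chartEnergy hφ)
        (fun z hz u hu ↦ F.chartEnergy_posDef hφ hz hu) (hy t ht) (hv t ht) (hmem t ht)
        (hne t ht)).mpr rfl
      rw [hvt, a3]
      refine h.congr_of_eventuallyEq ?_
      filter_upwards [hse, hv'] with s hs hs'
      rw [hs', (hxy s hs.1 hs.2).2.2]

end FinslerMetric

end Curves

/-! ### Uniqueness of geodesics -/

section Exponential

variable {E : Type*} [NormedAddCommGroup E] [NormedSpace ℝ E]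
  {N : Type*} [TopologicalSpace N] [ChartedSpace E N]

theorem tangentBundle_mk_inj {q q' : N} {v v' : E}
    (h : (⟨q, v⟩ : TangentBundle 𝓘(ℝ, E) N) = ⟨q', v'⟩) : q = q' ∧ v = v' := by
  cases h
  exact ⟨rfl, rfl⟩

namespace FinslerMetric

variable [IsManifold 𝓘(ℝ, E) ∞ N] (F : FinslerMetric E N) [FiniteDimensional ℝ E]

/-- A regular geodesic: a `C^2` curve with nowhere vanishing velocity that solves the
Euler-Lagrange equation in all charts. -/
def IsRegularGeodesicOn (γ : ℝ → N) (J : Set ℝ) : Prop :=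
  ContMDiffOn 𝓘(ℝ, ℝ) 𝓘(ℝ, E) 2 γ J ∧
    ∀ t ∈ J, (curveVelocity (E := E) γ t).2 ≠ 0 ∧
      ∀ e ∈ IsManifold.maximalAtlas 𝓘(ℝ, E) ∞ N, γ t ∈ e.source → F.EulerLagrangeAt e γ t

omit [FiniteDimensional ℝ E] in
theorem IsRegularGeodesicOn.mono {F : FinslerMetric E N} {γ : ℝ → N} {J J' : Set ℝ}
    (h : F.IsRegularGeodesicOn γ J) (hJ : J' ⊆ J) : F.IsRegularGeodesicOn γ J' :=
  ⟨h.1.mono hJ, fun t ht ↦ h.2 t (hJ ht)⟩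

/-- Local uniqueness of regular geodesics. -/
theorem IsRegularGeodesicOn.eventuallyEq {F : FinslerMetric E N} {φ : OpenPartialHomeomorph N E}
    (hφ : φ ∈ IsManifold.maximalAtlas 𝓘(ℝ, E) ∞ N) {J : Set ℝ} (hJ : IsOpen J) {γ₁ γ₂ : ℝ → N}
    (h₁ : F.IsRegularGeodesicOn γ₁ J) (h₂ : F.IsRegularGeodesicOn γ₂ J) {t : ℝ} (ht : t ∈ J)
    (heq : γ₁ t = γ₂ t) (hs : γ₁ t ∈ φ.source) (hd : deriv (φ ∘ γ₁) t = deriv (φ ∘ γ₂) t) :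
    γ₁ =ᶠ[𝓝 t] γ₂ := by
  have hcont : ∀ γ : ℝ → N, F.IsRegularGeodesicOn γ J → γ t ∈ φ.source →
      ∀ᶠ s in 𝓝 t, γ s ∈ φ.source ∧ HasDerivAt (fun s ↦ (φ (γ s), deriv (φ ∘ γ) s))
        (F.geodesicField φ (φ (γ s), deriv (φ ∘ γ) s)) s := by
    intro γ h hγs
    have hev : ∀ᶠ s in 𝓝 t, s ∈ J ∧ γ s ∈ φ.source := (hJ.eventually_mem ht).and
      (((h.1 t ht).contMDiffAt (hJ.mem_nhds ht)).continuousAt.eventually_mem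
        (φ.open_source.mem_nhds hγs))
    filter_upwards [hev] with s hs
    exact ⟨hs.2, F.hasDerivAt_of_eulerLagrangeAt hφ ((h.1 s hs.1).contMDiffAt (hJ.mem_nhds hs.1))
      hs.2 (h.2 s hs.1).1 ((h.2 s hs.1).2 φ hφ hs.2)⟩
  have e₁ := hcont γ₁ h₁ hs
  have e₂ := hcont γ₂ h₂ (heq ▸ hs)
  have hne : deriv (φ ∘ γ₁) t ≠ 0 := by
    rw [(hasDerivAt_chart_comp hφ (((h₁.1 t ht).contMDiffAt
      (hJ.mem_nhds ht)).mdifferentiableAt two_ne_zero) hs).deriv]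
    intro h
    exact (h₁.2 t ht).1 ((mdifferentiable_of_mem_maximalAtlas hφ).mfderiv_injective hs
      (h.trans (map_zero (mfderiv 𝓘(ℝ, E) 𝓘(ℝ, E) φ (γ₁ t))).symm))
  -- At a nonzero velocity the field is smooth, hence locally Lipschitz, and ODE uniqueness applies.
  have hX : ContDiffAt ℝ 1 (F.geodesicField φ) (φ (γ₁ t), deriv (φ ∘ γ₁) t) := by
    refine contDiffAt_snd.prodMk ?_
    have hQ := contDiffOn_lagrangianSpray φ.open_target (F.contDiffOn_chartEnergy hφ)
      (fun z hz u hu ↦ F.chartEnergy_posDef hφ hz hu)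
    exact (hQ.contDiffAt (x := (φ (γ₁ t), deriv (φ ∘ γ₁) t)) ((φ.open_target.prod isOpen_compl_singleton).mem_nhds
      ⟨φ.map_source hs, hne⟩)).of_le (by simp)
  obtain ⟨K, S, hS, hlip⟩ := hX.exists_lipschitzOnWith
  have hS₂ : S ∈ 𝓝 (φ (γ₂ t), deriv (φ ∘ γ₂) t) := by rwa [← heq, ← hd]
  have key := ODE_solution_unique_of_eventually (v := fun _ ↦ F.geodesicField φ) (s := fun _ ↦ S)
    (K := K) (t₀ := t) (f := fun s ↦ (φ (γ₁ s), deriv (φ ∘ γ₁) s))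
    (g := fun s ↦ (φ (γ₂ s), deriv (φ ∘ γ₂) s)) (Eventually.of_forall fun _ ↦ hlip)
    ((e₁.mono fun s hs ↦ hs.2).and (e₁.self_of_nhds.2.continuousAt.eventually_mem hS))
    ((e₂.mono fun s hs ↦ hs.2).and (e₂.self_of_nhds.2.continuousAt.eventually_mem hS₂))
    (by simp only [heq, hd])
  filter_upwards [key, e₁, e₂] with s hs hs₁ hs₂
  exact φ.injOn hs₁.1 hs₂.1 (congrArg Prod.fst hs)

/-- Uniqueness of regular geodesics with given initial velocity. -/
theorem IsRegularGeodesicOn.eqOn [T2Space N] {F : FinslerMetric E N} {J : Set ℝ} (hJ : IsOpen J)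
    (hJc : IsPreconnected J) {γ₁ γ₂ : ℝ → N} (h₁ : F.IsRegularGeodesicOn γ₁ J)
    (h₂ : F.IsRegularGeodesicOn γ₂ J) {t₀ : ℝ} (ht₀ : t₀ ∈ J)
    (heq : curveVelocity (E := E) γ₁ t₀ = curveVelocity γ₂ t₀) : EqOn γ₁ γ₂ J := by
  have hC : ∀ γ : ℝ → N, F.IsRegularGeodesicOn γ J → ∀ t ∈ J,
      ContMDiffAt 𝓘(ℝ, ℝ) 𝓘(ℝ, E) 2 γ t := fun γ h t ht ↦
    (h.1 t ht).contMDiffAt (hJ.mem_nhds ht)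
  suffices hsub : J ⊆ {t | γ₁ =ᶠ[𝓝 t] γ₂} from fun t ht ↦ (hsub ht).self_of_nhds
  -- Connectedness: the set where the germs agree is open. At a limit point in `J`, positions and
  -- chart velocities agree by continuity (positions by Hausdorffness), and local uniqueness extends
  -- the agreement.
  refine hJc.subset_of_closure_inter_subset isOpen_setOfPred_eventually_nhds ⟨t₀, ht₀, ?_⟩ ?_
  · obtain ⟨hq, hv⟩ := tangentBundle_mk_inj heq
    have hφ := IsManifold.chart_mem_maximalAtlas (I := 𝓘(ℝ, E)) (n := ∞) (γ₁ t₀)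
    refine h₁.eventuallyEq hφ hJ h₂ ht₀ hq (mem_chart_source E _) ?_
    rw [(hasDerivAt_chart_comp hφ ((hC γ₁ h₁ t₀ ht₀).mdifferentiableAt two_ne_zero)
      (mem_chart_source E _)).deriv, (hasDerivAt_chart_comp hφ
      ((hC γ₂ h₂ t₀ ht₀).mdifferentiableAt two_ne_zero) (hq ▸ mem_chart_source E _)).deriv]
    have h3 : ∀ q : N, γ₁ t₀ = q → ∀ v w : E, v = w →
        (mfderiv 𝓘(ℝ, E) 𝓘(ℝ, E) (chartAt E (γ₁ t₀)) (γ₁ t₀) v : E) =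
          mfderiv 𝓘(ℝ, E) 𝓘(ℝ, E) (chartAt E (γ₁ t₀)) q w := by
      rintro q rfl v w rfl
      rfl
    exact h3 _ hq _ _ hv
  · rintro t ⟨htc, ht⟩
    have : (𝓝[{t | γ₁ =ᶠ[𝓝 t] γ₂}] t).NeBot := mem_closure_iff_nhdsWithin_neBot.mp htc
    have hmem : ∀ᶠ s in 𝓝[{t | γ₁ =ᶠ[𝓝 t] γ₂}] t, γ₁ =ᶠ[𝓝 s] γ₂ := self_mem_nhdsWithin
    have hcγ : ∀ γ : ℝ → N, F.IsRegularGeodesicOn γ J →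
        Tendsto γ (𝓝[{t | γ₁ =ᶠ[𝓝 t] γ₂}] t) (𝓝 (γ t)) := fun γ h ↦
      (hC γ h t ht).continuousAt.tendsto.mono_left nhdsWithin_le_nhds
    have hq : γ₁ t = γ₂ t := by
      refine tendsto_nhds_unique_of_eventuallyEq (hcγ γ₁ h₁) (hcγ γ₂ h₂) ?_
      filter_upwards [hmem] with s hs
      exact hs.self_of_nhds
    have hφ := IsManifold.chart_mem_maximalAtlas (I := 𝓘(ℝ, E)) (n := ∞) (γ₁ t)
    have hs₁ : γ₁ t ∈ (chartAt E (γ₁ t)).source := mem_chart_source E _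
    have hs₂ : γ₂ t ∈ (chartAt E (γ₁ t)).source := hq ▸ hs₁
    refine h₁.eventuallyEq hφ hJ h₂ ht hq hs₁ ?_
    have hcd : ∀ γ : ℝ → N, F.IsRegularGeodesicOn γ J → γ t ∈ (chartAt E (γ₁ t)).source →
        Tendsto (deriv (chartAt E (γ₁ t) ∘ γ)) (𝓝[{t | γ₁ =ᶠ[𝓝 t] γ₂}] t)
          (𝓝 (deriv (chartAt E (γ₁ t) ∘ γ) t)) := by
      intro γ h hs
      have h1 := ((contDiffAt_chart_comp hφ (hC γ h t ht) hs).fderiv_right (m := 1)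
        (by norm_num)).clm_apply (contDiffAt_const (c := (1 : ℝ)))
      have h2 : ContinuousAt (deriv (chartAt E (γ₁ t) ∘ γ)) t := by simpa using h1.continuousAt
      exact h2.tendsto.mono_left nhdsWithin_le_nhds
    refine tendsto_nhds_unique_of_eventuallyEq (hcd γ₁ h₁ hs₁) (hcd γ₂ h₂ hs₂) ?_
    filter_upwards [hmem] with s hs
    exact (hs.fun_comp (chartAt E (γ₁ t))).deriv_eq

end FinslerMetric

end Exponential

/-! ### The exponential map as a rescaled flow -/

section ExponentialRegularity

variable {E : Type*} [NormedAddCommGroup E] [NormedSpace ℝ E]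
  {N : Type*} [TopologicalSpace N] [ChartedSpace E N]

theorem curveVelocity_eq_zero_of_eventuallyEq_const {γ : ℝ → N} {t : ℝ} {q : N}
    (h : ∀ᶠ s in 𝓝 t, γ s = q) : (curveVelocity (E := E) γ t).2 = 0 := by
  have h1 : HasMFDerivAt 𝓘(ℝ, ℝ) 𝓘(ℝ, E) γ t _ := (hasMFDerivAt_const (I := 𝓘(ℝ, ℝ))
    (I' := 𝓘(ℝ, E)) q t).congr_of_eventuallyEq h
  have h2 : (curveVelocity (E := E) γ t).2 = mfderiv 𝓘(ℝ, ℝ) 𝓘(ℝ, E) γ t (1 : ℝ) := rfl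
  rw [h2, h1.mfderiv]
  rfl

namespace FinslerMetric

variable [IsManifold 𝓘(ℝ, E) ∞ N] (F : FinslerMetric E N)

/-- `exp` picks a geodesic by choice, so its value is determined by showing that all candidates
agree at time 1. -/
theorem exp_eq_of_forall {p q : N} {v : E} (hv : v ∈ F.expDomain p)
    (h : ∀ γ : ℝ → N, curveVelocity (E := E) γ 0 = ⟨p, v⟩ → ∀ ε : ℝ, 0 < ε →
      F.IsGeodesicOn γ (Ioo (-ε) (1 + ε)) → γ 1 = q) : F.exp p v = q := by
  have hexp : F.exp p v = hv.choose 1 := dif_pos hv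
  rw [hexp]
  obtain ⟨h1, ε, h2, h3⟩ := hv.choose_spec
  exact h _ h1 ε h2 h3

/-- A geodesic with zero initial velocity is constant, since the other kind has nowhere vanishing
velocity. -/
theorem exp_zero (p : N) : (0 : E) ∈ F.expDomain p ∧ F.exp p (0 : E) = p := by
  have hdom : (0 : E) ∈ F.expDomain p := by
    refine ⟨fun _ ↦ p, tangentBundle_mk_eq rfl ?_, 1, one_pos, contMDiffOn_const,
      Or.inl ⟨p, fun _ _ ↦ rfl⟩⟩
    exact curveVelocity_eq_zero_of_eventuallyEq_const (E := E) (γ := fun _ ↦ p) (t := 0)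
      (Eventually.of_forall fun _ ↦ rfl)
  refine ⟨hdom, F.exp_eq_of_forall hdom fun γ hγ ε hε hgeo ↦ ?_⟩
  obtain ⟨hq, hv⟩ := tangentBundle_mk_inj hγ
  rcases hgeo.2 with ⟨q, hconst⟩ | hreg
  · rw [hconst 1 ⟨by linarith, by linarith⟩, ← hq]
    exact (hconst 0 ⟨by linarith, by linarith⟩).symm
  · exact absurd hv (hreg 0 ⟨by linarith, by linarith⟩).1

/-- Since `v ≠ 0`, no competitor is constant; a regular one agrees with `c` on the smaller of the
two intervals. -/
theorem exp_eq_of_isRegularGeodesicOn [T2Space N] [FiniteDimensional ℝ E] {p : N} {v : E} {η : ℝ}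
    (hη : 0 < η) {c : ℝ → N} (hc : F.IsRegularGeodesicOn c (Ioo (-η) (1 + η)))
    (h0 : curveVelocity (E := E) c 0 = ⟨p, v⟩) : v ∈ F.expDomain p ∧ F.exp p v = c 1 := by
  have hdom : v ∈ F.expDomain p := ⟨c, h0, η, hη, hc.1, Or.inr hc.2⟩
  refine ⟨hdom, F.exp_eq_of_forall hdom fun γ hγ ε hε hgeo ↦ ?_⟩
  have hne : v ≠ 0 := by
    obtain ⟨_, hv⟩ := tangentBundle_mk_inj h0
    have := (hc.2 0 ⟨by linarith, by linarith⟩).1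
    rintro rfl
    exact this hv
  obtain ⟨_, hγv⟩ := tangentBundle_mk_inj hγ
  rcases hgeo.2 with ⟨q, hconst⟩ | hreg
  · refine absurd ?_ hne
    rw [← hγv]
    refine curveVelocity_eq_zero_of_eventuallyEq_const (E := E) (q := q) ?_
    filter_upwards [Ioo_mem_nhds (show -ε < (0 : ℝ) by linarith)
      (show (0 : ℝ) < 1 + ε by linarith)] with s hs
    exact hconst s hs
  · set ζ := min ε η
    have hζ : 0 < ζ := lt_min hε hη
    have hζε : ζ ≤ ε := min_le_left _ _
    have hζη : ζ ≤ η := min_le_right _ _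
    have r₁ : F.IsRegularGeodesicOn γ (Ioo (-ε) (1 + ε)) := ⟨hgeo.1, hreg⟩
    exact (r₁.mono (Ioo_subset_Ioo (by linarith) (by linarith))).eqOn isOpen_Ioo
      isPreconnected_Ioo (hc.mono (J' := Ioo (-ζ) (1 + ζ))
        (Ioo_subset_Ioo (by linarith) (by linarith)))
      (t₀ := 0) ⟨by linarith, by linarith⟩ (hγ.trans h0.symm) ⟨by linarith, by linarith⟩

/-- Near the zero vector over `p` the geodesic field has a Lipschitz continuous derivative. -/
theorem exists_lipschitzOnWith_fderiv_geodesicField [FiniteDimensional ℝ E]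
    {φ : OpenPartialHomeomorph N E} (hφ : φ ∈ IsManifold.maximalAtlas 𝓘(ℝ, E) ∞ N) {x : E}
    (hx : x ∈ φ.target) :
    ∃ a : ℝ, 0 < a ∧ closedBall x a ⊆ φ.target ∧
      ∃ (DX : E × E → E × E →L[ℝ] E × E) (K : ℝ≥0),
        (∀ z ∈ closedBall (x, (0 : E)) a, HasFDerivAt (F.geodesicField φ) (DX z) z) ∧
        LipschitzOnWith K DX (closedBall (x, (0 : E)) a) := by
  obtain ⟨a, ha, haU, K, hQ, hlip⟩ := exists_lipschitzOnWith_fderiv_of_homogeneous φ.open_target hx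
    ((contDiffOn_lagrangianSpray φ.open_target (F.contDiffOn_chartEnergy hφ)
      (fun z hz u hu ↦ F.chartEnergy_posDef hφ hz hu)).of_le ENat.LEInfty.out)
    (fun x hx v r hr ↦ lagrangianSpray_smul φ.open_target (F.contDiffOn_chartEnergy hφ)
      (fun x _ v r hr ↦ F.chartEnergy_smul x v hr) hx v hr)
  refine ⟨a, ha, haU, fun z ↦ (ContinuousLinearMap.snd ℝ E E).prod
    (fderiv ℝ (lagrangianSpray (F.chartEnergy φ)) z), K, fun z hz ↦
    hasFDerivAt_snd.prodMk (hQ z hz), LipschitzOnWith.of_dist_le_mul fun z hz z' hz' ↦ ?_⟩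
  refine le_trans ?_ (hlip.dist_le_mul z hz z' hz')
  rw [dist_eq_norm, dist_eq_norm]
  refine ContinuousLinearMap.opNorm_le_bound _ (norm_nonneg _) fun w ↦ ?_
  refine max_le ?_ ?_
  · simp only [_root_.sub_apply, ContinuousLinearMap.prod_apply, Prod.fst_sub, sub_self, norm_zero]
    positivity
  · exact ContinuousLinearMap.le_opNorm (fderiv ℝ (lagrangianSpray (F.chartEnergy φ)) z -
      fderiv ℝ (lagrangianSpray (F.chartEnergy φ)) z') w

/-- In a chart around `p`, the exponential map is differentiable near the origin with Lipschitz
continuous derivative. -/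
theorem exists_exp_eq_chart_symm [T2Space N] [FiniteDimensional ℝ E] {p : N}
    {φ : OpenPartialHomeomorph N E} (hφ : φ ∈ IsManifold.maximalAtlas 𝓘(ℝ, E) ∞ N)
    (hp : p ∈ φ.source) :
    ∃ ε : ℝ, 0 < ε ∧ ∃ (Φ : E → E) (DΦ : E → E →L[ℝ] E) (C : ℝ≥0),
      (∀ v ∈ ball (0 : E) ε, Φ v ∈ φ.target ∧ v ∈ F.expDomain p ∧ F.exp p v = φ.symm (Φ v)) ∧
      (∀ v ∈ ball (0 : E) ε, HasFDerivAt Φ (DΦ v) v) ∧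
      LipschitzOnWith C DΦ (ball (0 : E) ε) := by
  have : CompleteSpace E := FiniteDimensional.complete ℝ E
  set x₀ := φ p
  obtain ⟨a, ha, haU, DX, K, hX, hDX⟩ :=
    F.exists_lipschitzOnWith_fderiv_geodesicField hφ (φ.map_source hp)
  obtain ⟨B, -, hXlip⟩ := exists_lipschitzOnWith_of_lipschitzOnWith_fderiv ha hX hDX
  obtain ⟨T, hT, r, hr, α, A, C, hα, hA⟩ := exists_flow_of_lipschitzOnWith_fderiv ha hX hDX
  -- With this choice `δ * t` stays in `(-T, T)` for `t` in `(-1/2, 3/2)`, an open interval around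
  -- `[0, 1]`.
  set δ : ℝ := T / 2 with hδ
  have hδ0 : 0 < δ := by positivity
  obtain ⟨hA1, hA2⟩ := hA δ ⟨hδ0.le, by linarith⟩
  let D : E →L[ℝ] E := mfderiv 𝓘(ℝ, E) 𝓘(ℝ, E) φ p
  have hDinv : ∀ v : E, (mfderiv 𝓘(ℝ, E) 𝓘(ℝ, E) φ.symm x₀ (D v) : E) = v := fun v ↦
    congrArg (fun A : E →L[ℝ] E ↦ A v)
      ((mdifferentiable_of_mem_maximalAtlas hφ).symm_comp_deriv hp)
  -- The initial velocity is multiplied by `δ⁻¹` to make up for flowing only for time `δ`.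
  let S : E →L[ℝ] E × E := ContinuousLinearMap.inr ℝ E E ∘L (δ⁻¹ • D)
  let Z : E → E × E := fun v ↦ (x₀, (0 : E)) + S v
  have hZ : ∀ v, Z v = (x₀, δ⁻¹ • D v) := fun v ↦ by simp [Z, S]
  have hZd : ∀ v, HasFDerivAt Z S v := fun v ↦ S.hasFDerivAt.const_add _
  set ε : ℝ := r / (‖S‖ + 1) with hε
  have hZmem : ∀ v ∈ ball (0 : E) ε, Z v ∈ ball (x₀, (0 : E)) r := by
    intro v hv
    rw [mem_ball_zero_iff, hε, lt_div_iff₀ (by positivity)] at hv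
    rw [mem_ball_iff_norm, add_sub_cancel_left]
    calc ‖S v‖ ≤ ‖S‖ * ‖v‖ := S.le_opNorm v
      _ ≤ ‖v‖ * (‖S‖ + 1) := by nlinarith [norm_nonneg v]
      _ < r := hv
  -- Zero vectors are equilibria and the field is Lipschitz there too, so a trajectory reaching one
  -- is constant. Hence velocities that start nonzero never vanish.
  have hstat : ∀ v ∈ ball (0 : E) ε, ∀ t ∈ Ioo (-T) T, (α (Z v) t).2 = 0 →
      ∀ s ∈ Ioo (-T) T, α (Z v) s = α (Z v) t := by
    intro v hv t ht h0 s hs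
    obtain ⟨_, h2, h3⟩ := hα _ (hZmem v hv)
    refine ODE_solution_unique_of_mem_Ioo (v := fun _ ↦ F.geodesicField φ)
      (s := fun _ ↦ closedBall (x₀, (0 : E)) a) (K := B) (fun _ _ ↦ hXlip) ht
      (g := fun _ ↦ α (Z v) t) (fun s hs ↦ ⟨h3 s hs, h2 s⟩) (fun s _ ↦ ⟨?_, h2 t⟩) rfl hs
    have : F.geodesicField φ (α (Z v) t) = 0 := by
      rw [FinslerMetric.geodesicField, lagrangianSpray, if_pos h0, h0]
      rfl
    rw [this]
    exact hasDerivAt_const _ _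
  have hmemT : ∀ v ∈ ball (0 : E) ε, ∀ t, (α (Z v) t).1 ∈ φ.target := by
    intro v hv t
    have := (hα _ (hZmem v hv)).2.1 t
    rw [← closedBall_prod_same] at this
    exact haU this.1
  -- One factor `‖S‖` comes from the dependence of `Z v` on `v`, the other from the chain rule.
  refine ⟨ε, by positivity, fun v ↦ (α (Z v) δ).1,
    fun v ↦ ContinuousLinearMap.fst ℝ E E ∘L A (Z v) δ ∘L S,
    C * ‖S‖₊ ^ 2, fun v hv ↦ ⟨hmemT v hv δ, ?_⟩, fun v hv ↦ ?_, ?_⟩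
  · obtain ⟨hz0, h2, h3⟩ := hα _ (hZmem v hv)
    have h0T : (0 : ℝ) ∈ Ioo (-T) T := ⟨by linarith, hT⟩
    have hδT : δ ∈ Ioo (-T) T := ⟨by linarith, by linarith⟩
    by_cases hv0 : v = 0
    · subst hv0
      have hz : (α (Z 0) 0).2 = 0 := by rw [hz0, hZ]; simp
      have h4 : α (Z 0) δ = α (Z 0) 0 := hstat 0 hv 0 h0T hz δ hδT
      obtain ⟨h5, h6⟩ := F.exp_zero (E := E) p
      refine ⟨h5, h6.trans ?_⟩
      change p = φ.symm (α (Z 0) δ).1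
      rw [h4, hz0, hZ]
      exact (φ.left_inv hp).symm
    set y : ℝ → E := fun t ↦ (α (Z v) (δ * t)).1 with hy
    set w : ℝ → E := fun t ↦ δ • (α (Z v) (δ * t)).2 with hw
    have hJ : ∀ t ∈ Ioo (-(1 / 2) : ℝ) (1 + 1 / 2), δ * t ∈ Ioo (-T) T := by
      intro t ht
      constructor <;> nlinarith [ht.1, ht.2]
    have hflow : ∀ t ∈ Ioo (-(1 / 2) : ℝ) (1 + 1 / 2),
        HasDerivAt (fun t ↦ α (Z v) (δ * t)) (δ • F.geodesicField φ (α (Z v) (δ * t))) t := by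
      intro t ht
      have h4 : HasDerivAt (fun t : ℝ ↦ δ * t) δ t := by
        simpa using (hasDerivAt_id t).const_mul δ
      exact (h3 _ (hJ t ht)).scomp t h4
    have hyd : ∀ t ∈ Ioo (-(1 / 2) : ℝ) (1 + 1 / 2), HasDerivAt y (w t) t := fun t ht ↦
      (hflow t ht).fst
    have hwd : ∀ t ∈ Ioo (-(1 / 2) : ℝ) (1 + 1 / 2),
        HasDerivAt w (lagrangianSpray (F.chartEnergy φ) (y t, w t)) t := by
      intro t ht
      have h4 : HasDerivAt (fun t ↦ (α (Z v) (δ * t)).2)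
          (δ • lagrangianSpray (F.chartEnergy φ) (α (Z v) (δ * t))) t := (hflow t ht).snd
      refine (h4.const_smul δ).congr_deriv ?_
      -- Slowing time by `δ` multiplies acceleration by `δ²`, matching the 2-homogeneity of the
      -- spray.
      rw [lagrangianSpray_smul φ.open_target (F.contDiffOn_chartEnergy hφ)
        (fun x _ v r hr ↦ F.chartEnergy_smul x v hr) (hmemT v hv _) _ hδ0.le, pow_two, mul_smul]
    have hDv : D v ≠ 0 := by
      intro h
      have := hDinv v
      rw [h] at this
      exact hv0 (this.symm.trans (map_zero (mfderiv 𝓘(ℝ, E) 𝓘(ℝ, E) φ.symm x₀)))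
    have hwne : ∀ t ∈ Ioo (-(1 / 2) : ℝ) (1 + 1 / 2), w t ≠ 0 := by
      intro t ht h
      have h4 : (α (Z v) (δ * t)).2 = 0 := (smul_eq_zero.mp h).resolve_left hδ0.ne'
      have h5 := hstat v hv _ (hJ t ht) h4 0 h0T
      rw [← h5, hz0, hZ] at h4
      exact hDv ((smul_eq_zero.mp h4).resolve_left (inv_ne_zero hδ0.ne'))
    have hgeo := F.isGeodesicOn_of_hasDerivAt hφ isOpen_Ioo hyd hwd
      (fun t _ ↦ hmemT v hv _) hwne
    have h0J : (0 : ℝ) ∈ Ioo (-(1 / 2) : ℝ) (1 + 1 / 2) := by norm_num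
    have hy0 : y 0 = x₀ := by
      simp only [hy, mul_zero, hz0]
      rw [hZ]
    have hw0 : w 0 = D v := by
      simp only [hw, mul_zero, hz0]
      rw [hZ]
      exact smul_inv_smul₀ hδ0.ne' _
    have hvel : curveVelocity (E := E) (φ.symm ∘ y) 0 = ⟨p, v⟩ := by
      refine tangentBundle_mk_eq ?_ ?_
      · rw [Function.comp_apply, hy0]
        exact φ.left_inv hp
      · refine (mfderiv_chart_symm_comp hφ (hyd 0 h0J) (hmemT v hv _)).trans ?_
        rw [hy0, hw0]
        exact hDinv v
    have hreg : F.IsRegularGeodesicOn (φ.symm ∘ y) (Ioo (-(1 / 2) : ℝ) (1 + 1 / 2)) := by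
      refine ⟨hgeo.1, hgeo.2.resolve_left ?_⟩
      rintro ⟨q, hq⟩
      refine hv0 ?_
      rw [← (tangentBundle_mk_inj hvel).2]
      refine curveVelocity_eq_zero_of_eventuallyEq_const (E := E) (q := q) ?_
      filter_upwards [isOpen_Ioo.mem_nhds h0J] with s hs
      exact hq s hs
    obtain ⟨h5, h6⟩ := F.exp_eq_of_isRegularGeodesicOn (by norm_num) hreg hvel
    refine ⟨h5, h6.trans ?_⟩
    simp only [Function.comp_apply, hy, mul_one]
  · exact hasFDerivAt_fst.comp v ((hA1 _ (hZmem v hv)).comp v (hZd v))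
  · refine LipschitzOnWith.of_dist_le_mul fun v hv w hw ↦ ?_
    have h1 : ‖A (Z v) δ - A (Z w) δ‖ ≤ C * (‖S‖ * ‖v - w‖) := by
      refine (hA2.norm_sub_le (hZmem v hv) (hZmem w hw)).trans ?_
      have : Z v - Z w = S (v - w) := by simp [Z]
      rw [this]
      gcongr
      exact S.le_opNorm _
    have h2 : ContinuousLinearMap.fst ℝ E E ∘L A (Z v) δ ∘L S -
        ContinuousLinearMap.fst ℝ E E ∘L A (Z w) δ ∘L S =
        ContinuousLinearMap.fst ℝ E E ∘L (A (Z v) δ - A (Z w) δ) ∘L S := by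
      ext u; simp
    rw [dist_eq_norm, dist_eq_norm, h2]
    calc _ ≤ ‖ContinuousLinearMap.fst ℝ E E‖ * (‖A (Z v) δ - A (Z w) δ‖ * ‖S‖) :=
          (ContinuousLinearMap.opNorm_comp_le _ _).trans
            (by gcongr; exact ContinuousLinearMap.opNorm_comp_le _ _)
      _ ≤ 1 * ((C * (‖S‖ * ‖v - w‖)) * ‖S‖) := by
          gcongr
          exact ContinuousLinearMap.norm_fst_le ..
      _ = _ := by
          push_cast
          ring

end FinslerMetric

end ExponentialRegularity

/-! ### Regularity of the exponential map in the given chart -/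

theorem mainTheorem6 {E : Type*} [NormedAddCommGroup E] [NormedSpace ℝ E] [FiniteDimensional ℝ E]
    {N : Type*} [TopologicalSpace N] [T2Space N] [ChartedSpace E N] [IsManifold 𝓘(ℝ, E) ∞ N]
    (F : FinslerMetric E N) (p : N)
    (φ : OpenPartialHomeomorph N E) (hφ : φ ∈ IsManifold.maximalAtlas 𝓘(ℝ, E) ∞ N)
    (hp : p ∈ φ.source) :
    ∃ ε : ℝ, 0 < ε ∧ ∃ C : ℝ≥0,
      (∀ v ∈ ball (0 : E) ε, v ∈ F.expDomain p ∧ F.exp p v ∈ φ.source) ∧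
      ContDiffOn ℝ 1 (fun v : E => φ (F.exp p v)) (ball (0 : E) ε) ∧
      LipschitzOnWith C (fderiv ℝ (fun v : E => φ (F.exp p v))) (ball (0 : E) ε) := by
  obtain ⟨ε, hε, Φ, DΦ, C, hΦ, hd, hlip⟩ := F.exists_exp_eq_chart_symm hφ hp
  have heq : ∀ v ∈ ball (0 : E) ε, φ (F.exp p v) = Φ v := by
    intro v hv
    obtain ⟨h1, _, h3⟩ := hΦ v hv
    rw [h3, φ.right_inv h1]
  have hder : ∀ v ∈ ball (0 : E) ε, HasFDerivAt (fun v : E => φ (F.exp p v)) (DΦ v) v := by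
    intro v hv
    refine (hd v hv).congr_of_eventuallyEq ?_
    filter_upwards [isOpen_ball.mem_nhds hv] with u hu
    exact heq u hu
  have hfd : EqOn (fderiv ℝ (fun v : E => φ (F.exp p v))) DΦ (ball (0 : E) ε) := fun v hv ↦
    (hder v hv).fderiv
  refine ⟨ε, hε, C, fun v hv ↦ ?_, ?_, ?_⟩
  · obtain ⟨h1, h2, h3⟩ := hΦ v hv
    exact ⟨h2, h3 ▸ φ.map_target h1⟩
  · rw [← zero_add 1, contDiffOn_succ_iff_fderiv_of_isOpen isOpen_ball, contDiffOn_zero]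
    exact ⟨fun v hv ↦ (hder v hv).differentiableAt.differentiableWithinAt, by simp,
      hlip.continuousOn.congr hfd⟩
  · intro v hv w hw
    rw [hfd hv, hfd hw]
    exact hlip hv hw
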